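/- Let $(X_k)_{k\ge 1}$ be independent identically distributed real random variables with $E[X_k]=0$ and $E[X_k^2]=1$. Let $\mathcal N$ be the standard normal law and let $d_W(Y,\mathcal N)=\sup_h |E[h(Y)]-\int h\,d\mathcal N|$, the supremum being over all $h:\mathbb R\to\mathbb R$ that are Lipschitz with constant at most $1$. Let $n\ge 2$, let $A=(a_{k,l})_{1\le k,l\le n}$ be a real symmetric matrix with vanishing diagonal, and put $Q_n=\sum_{1\le k,l\le n}a_{k,l}X_kX_l$. Assume that $E[Q_n^2]=1$ (one has $E[Q_n]=0$ automatically). Then, the right-hand sides being $+\infty$ when $E[X_1^4]=\infty$, $$d_W(Q_n,\mathcal N)\le 2\sqrt{E[X_1^4]\sum_{l=1}^n\Big(\sum_{k=1}^n a_{k,l}^2\Big)^2+2\sum_{1\le l,p\le n}\Big(\sum_{k=1}^n a_{k,l}a_{k,p}\Big)^2}+4\sqrt{\big(3E[X_1^4]+(E[X_1^4])^2\big)\sum_{k=1}^n\Big(\sum_{l=1}^n a_{k,l}^2\Big)^2}.$$ Consequently, with $L_n^2:=\max_{1\le k\le n}\sum_{l=1}^n a_{k,l}^2$ (which is positive, and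 $L_n^4:=(L_n^2)^2$), $$d_W(Q_n,\mathcal N)\le 2\sqrt n\,L_n^2\left(\sqrt{E[X_1^4]+\frac{2}{nL_n^4}\sum_{1\le l,p\le n}\Big(\sum_{k=1}^n a_{k,l}a_{k,p}\Big)^2}+2\sqrt{3E[X_1^4]+(E[X_1^4])^2}\right).$$ In particular, the rate $1/\sqrt n$ is attained in the following example: for every $n\ge 1$, $$d_W\Big(\frac1{\sqrt n}\sum_{k=1}^n X_{2k-1}X_{2k},\ \mathcal N\Big)\le\frac{8\,E[X_1^4]}{\sqrt n}.$$ -/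

import Mathlib

open MeasureTheory ProbabilityTheory
open scoped ENNReal

noncomputable section

/-- The Wasserstein distance `sup_{h ∈ Lip(1)} |∫ h dμ - ∫ h dν|` between two laws on the real line
with finite first moment (so that every Lipschitz `h` is integrable). It takes its values in
`[0, ∞]`, so that the supremum is always a genuine one. -/
def wassersteinDist (μ ν : Measure ℝ) : ℝ≥0∞ :=
  ⨆ (h : ℝ → ℝ) (_ : LipschitzWith 1 h), ENNReal.ofReal |∫ x, h x ∂μ - ∫ x, h x ∂ν|

/-- The quadratic form `∑_{k,l} a_{k,l} X_k X_l` in the first `n` variables of the sequence `X`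
(numbered from `0`). -/
def quadForm {Ω : Type*} {n : ℕ} (A : Matrix (Fin n) (Fin n) ℝ) (X : ℕ → Ω → ℝ) (ω : Ω) : ℝ :=
  ∑ k : Fin n, ∑ l : Fin n, A k l * X k ω * X l ω

/-- The quantity `L_n² = max_k ∑_l a_{k,l}²`. -/
def maxRowSq {n : ℕ} (A : Matrix (Fin n) (Fin n) ℝ) : ℝ :=
  ⨆ k : Fin n, ∑ l : Fin n, A k l ^ 2

/-- The fourth moment `E[Y⁴]`, with value in `[0, ∞]`. -/
def fourthMoment {Ω : Type*} [MeasurableSpace Ω] (P : Measure Ω) (Y : Ω → ℝ) : ℝ≥0∞ :=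
  ∫⁻ ω, ENNReal.ofReal (Y ω ^ 4) ∂P

end

/-! Stein's method. After smoothing a 1-Lipschitz `h` to a `C¹` function, the equation `f' - x f = h
- E h(Z)` has a solution with `|f'| ≤ 1` and `f'` 2-Lipschitz (`exists_stein_solution`), so it is
enough to bound `E[f'(Q) - Q f(Q)]` for such `f`.

Write `Q = ∑ X_k Y_k` with `Y_k = ∑_l a_{k,l} X_l`. Since the diagonal vanishes, `X_k` is
independent of the pair `(Y_k, Q - 2 X_k Y_k)`. Expanding in `X_k` alone replaces `E[X_k Y_k f(Q)]`
by `E[2 Y_k² f'(Q)]`, with an error of order `E|Y_k|³` (`abs_integral_leave_one_out_le`). What is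
left is `E[(1 - 2 ∑ Y_k²) f'(Q)]`. The condition `E[Q²] = 1` means `∑ a_{k,l}² = 1/2`, so `2 ∑ Y_k²`
has mean 1, and Cauchy–Schwarz with the variance of this quadratic form yields the first square root
(`integral_abs_one_sub_le`).

With `m = E[X_1⁴]` and `s_k = ∑_l a_{k,l}²`, one has `E|Y_k|³ ≤ √(max m 3) s_k^{3/2}`;
Cauchy–Schwarz over `k` yields the second square root (`sum_integral_abs_pow_three_le`). The stated
constant 4 leaves little room, which is why the expansion in `X_k` is done with an optimised
intermediate point (`two_mul_zeroBiasBound_sq_le`).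

The form with `L_n` follows from `∑ s_k² ≤ n L_n⁴`; the example is the case where `AᵀA` is a
multiple of the identity. -/

set_option linter.unusedSectionVars false

/-! ### Tail inequalities for the standard normal law. -/

section GaussianTail

open Set Filter Topology

/-- The density of the standard normal law. -/
noncomputable def stdPdf (x : ℝ) : ℝ := (√(2 * Real.pi))⁻¹ * Real.exp (-x ^ 2 / 2)

/-- The upper tail of the standard normal law. -/
noncomputable def stdTail (w : ℝ) : ℝ := ∫ t in Ioi w, stdPdf t

/-- The mean excess `E[(Z - w)⁺]` of a standard normal variable `Z`. -/
noncomputable def stdExcess (w : ℝ) : ℝ := stdPdf w - w * stdTail w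

theorem stdPdf_eq (x : ℝ) : stdPdf x = gaussianPDFReal 0 1 x := by
  simp [stdPdf, gaussianPDFReal_def]

theorem stdPdf_pos (x : ℝ) : 0 < stdPdf x := by
  unfold stdPdf; positivity

theorem stdPdf_neg (x : ℝ) : stdPdf (-x) = stdPdf x := by simp [stdPdf]

theorem stdPdf_le_half (x : ℝ) : stdPdf x ≤ 1 / 2 := by
  have h1 : (2 : ℝ) ≤ √(2 * Real.pi) :=
    Real.le_sqrt_of_sq_le (by nlinarith [Real.pi_gt_three])
  have h2 : Real.exp (-x ^ 2 / 2) ≤ 1 := Real.exp_le_one_iff.2 (by nlinarith [sq_nonneg x])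
  have h3 : (√(2 * Real.pi))⁻¹ ≤ 1 / 2 := by
    rw [one_div]; exact inv_anti₀ (by norm_num) h1
  unfold stdPdf
  calc (√(2 * Real.pi))⁻¹ * Real.exp (-x ^ 2 / 2) ≤ 1 / 2 * 1 := by gcongr
    _ = 1 / 2 := mul_one _

theorem integrable_stdPdf : Integrable stdPdf := by
  rw [show stdPdf = gaussianPDFReal 0 1 from funext stdPdf_eq]
  exact integrable_gaussianPDFReal 0 1

theorem hasDerivAt_stdPdf (x : ℝ) : HasDerivAt stdPdf (-x * stdPdf x) x := by
  unfold stdPdf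
  have h : HasDerivAt (fun x : ℝ => -x ^ 2 / 2) (-x) x := by
    convert! ((hasDerivAt_pow 2 x).neg.div_const 2) using 1
    simp; ring
  convert! (h.exp.const_mul (√(2 * Real.pi))⁻¹) using 1
  ring

theorem continuous_stdPdf : Continuous stdPdf :=
  continuous_iff_continuousAt.2 fun x => (hasDerivAt_stdPdf x).continuousAt

theorem tendsto_pow_mul_stdPdf (k : ℕ) : Tendsto (fun x => x ^ k * stdPdf x) atTop (𝓝 0) := by
  have h := (tendsto_rpow_abs_mul_exp_neg_mul_sq_cocompact (a := 1 / 2) (by norm_num) k).mono_left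
    atTop_le_cocompact
  have h2 := h.const_mul (√(2 * Real.pi))⁻¹
  rw [mul_zero] at h2
  refine h2.congr' ?_
  filter_upwards [eventually_ge_atTop 0] with x hx
  rw [abs_of_nonneg hx, Real.rpow_natCast, stdPdf]
  ring_nf

theorem tendsto_stdPdf : Tendsto stdPdf atTop (𝓝 0) := by
  simpa using tendsto_pow_mul_stdPdf 0

theorem hasDerivAt_integral_Ioi {g : ℝ → ℝ} (hc : Continuous g)
    (hg : ∀ a, IntegrableOn g (Ioi a)) (w : ℝ) :
    HasDerivAt (fun w => ∫ t in Ioi w, g t) (-g w) w := by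
  have h : (fun w => ∫ t in Ioi w, g t) = fun w => (∫ t in Ioi 0, g t) - ∫ t in (0 : ℝ)..w, g t := by
    funext w
    rw [← intervalIntegral.integral_interval_add_Ioi (hg 0) (hg w)]
    ring
  rw [h]
  simpa using (intervalIntegral.integral_hasDerivAt_right (hc.intervalIntegrable 0 w)
    hc.stronglyMeasurable.stronglyMeasurableAtFilter hc.continuousAt).const_sub (∫ t in Ioi 0, g t)

theorem hasDerivAt_stdTail (w : ℝ) : HasDerivAt stdTail (-stdPdf w) w :=
  hasDerivAt_integral_Ioi continuous_stdPdf (fun _ => integrable_stdPdf.integrableOn) w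

theorem continuous_stdTail : Continuous stdTail :=
  continuous_iff_continuousAt.2 fun x => (hasDerivAt_stdTail x).continuousAt

theorem stdTail_nonneg (w : ℝ) : 0 ≤ stdTail w :=
  setIntegral_nonneg measurableSet_Ioi fun x _ => (stdPdf_pos x).le

theorem stdTail_add_neg (w : ℝ) : stdTail w + stdTail (-w) = 1 := by
  have h1 : stdTail (-w) = ∫ t in Iic w, stdPdf t := by
    have := integral_comp_neg_Ioi (-w) stdPdf
    simp only [stdPdf_neg, neg_neg] at this
    exact this
  have h2 : ∫ t, stdPdf t = 1 := by
    rw [show stdPdf = gaussianPDFReal 0 1 from funext stdPdf_eq]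
    exact integral_gaussianPDFReal_eq_one 0 one_ne_zero
  have h3 := integral_add_compl (s := Iic w) measurableSet_Iic integrable_stdPdf
  rw [compl_Iic] at h3
  rw [h1, ← h2, ← h3, stdTail, add_comm]

/-- For `t > w > 0` the density satisfies `w p(t) ≤ t p(t) = -p'(t)`, and the right-hand side
integrates to `p(w)` over the tail. -/
theorem mul_stdTail_le (w : ℝ) : w * stdTail w ≤ stdPdf w := by
  rcases le_or_gt w 0 with hw | hw
  · nlinarith [stdTail_nonneg w, stdPdf_pos w]
  have hd : ∀ x ∈ Ici w, HasDerivAt stdPdf (-x * stdPdf x) x := fun x _ => hasDerivAt_stdPdf x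
  have hn : ∀ x ∈ Ioi w, -x * stdPdf x ≤ 0 := fun x hx => by
    have : 0 < x := hw.trans hx
    nlinarith [stdPdf_pos x]
  have hi := integrableOn_Ioi_deriv_of_nonpos' hd hn tendsto_stdPdf
  have he := integral_Ioi_of_hasDerivAt_of_nonpos' hd hn tendsto_stdPdf
  have : ∫ t in Ioi w, w * stdPdf t ≤ ∫ t in Ioi w, -(-t * stdPdf t) := by
    refine setIntegral_mono_on (integrable_stdPdf.integrableOn.const_mul w) hi.neg
      measurableSet_Ioi fun x hx => ?_
    have : w < x := hx
    nlinarith [stdPdf_pos x]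
  rw [integral_const_mul, integral_neg, he] at this
  simpa [stdTail] using this

theorem tendsto_pow_mul_stdTail (k : ℕ) : Tendsto (fun x => x ^ k * stdTail x) atTop (𝓝 0) := by
  refine squeeze_zero' ?_ ?_ (tendsto_pow_mul_stdPdf k)
  · filter_upwards [eventually_ge_atTop 0] with x hx
    exact mul_nonneg (pow_nonneg hx k) (stdTail_nonneg x)
  · filter_upwards [eventually_ge_atTop 1] with x hx
    have h0 : (0 : ℝ) ≤ x := by linarith
    gcongr
    -- For `x ≥ 1` the tail is at most `x` times itself, hence at most the density.
    nlinarith [mul_stdTail_le x, stdTail_nonneg x]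

theorem stdExcess_nonneg (w : ℝ) : 0 ≤ stdExcess w := by
  linarith [mul_stdTail_le w, show stdExcess w = stdPdf w - w * stdTail w from rfl]

theorem hasDerivAt_stdExcess (w : ℝ) : HasDerivAt stdExcess (-stdTail w) w := by
  convert! (hasDerivAt_stdPdf w).sub ((hasDerivAt_id w).mul (hasDerivAt_stdTail w)) using 1
  simp

theorem tendsto_stdExcess : Tendsto stdExcess atTop (𝓝 0) := by
  simpa [stdExcess] using! (tendsto_pow_mul_stdPdf 0).sub (tendsto_pow_mul_stdTail 1)

theorem stdExcess_neg (w : ℝ) : stdExcess (-w) = stdExcess w + w := by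
  have := stdTail_add_neg w
  simp only [stdExcess, stdPdf_neg]
  linear_combination w * this

theorem nonneg_of_hasDerivAt_nonpos {f f' : ℝ → ℝ} (hf : ∀ x, HasDerivAt f (f' x) x)
    (hf' : ∀ x, f' x ≤ 0) (h0 : Tendsto f atTop (𝓝 0)) (x : ℝ) : 0 ≤ f x :=
  (antitone_of_hasDerivAt_nonpos hf hf').le_of_tendsto h0 x

/-- The Mills ratio inequality, valid for every real `w`. -/
theorem mul_stdPdf_le (w : ℝ) : w * stdPdf w ≤ (1 + w ^ 2) * stdTail w := by
  -- The difference of the two sides has derivative `-2 * stdExcess w ≤ 0` and tends to 0 at `+∞`.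
  have h := nonneg_of_hasDerivAt_nonpos
    (f := fun w => (1 + w ^ 2) * stdTail w - w * stdPdf w) (f' := fun w => -2 * stdExcess w)
    (fun w => ?_) (fun w => by linarith [stdExcess_nonneg w]) ?_ w
  · simpa using h
  · convert! (((hasDerivAt_pow 2 w).const_add 1).mul (hasDerivAt_stdTail w)).sub
      ((hasDerivAt_id w).mul (hasDerivAt_stdPdf w)) using 1
    simp [stdExcess]; ring
  · have := ((tendsto_pow_mul_stdTail 0).add (tendsto_pow_mul_stdTail 2)).sub
      (tendsto_pow_mul_stdPdf 1)
    simp only [add_zero, sub_zero] at this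
    exact this.congr fun x => by ring

/-- Birnbaum's inequality for the normal tail. -/
theorem sq_stdPdf_le (w : ℝ) : stdPdf w ^ 2 ≤ stdTail w ^ 2 + w * stdPdf w * stdTail w := by
  -- Same scheme; the sign of the derivative is now the Mills ratio inequality.
  have h := nonneg_of_hasDerivAt_nonpos
    (f := fun w => stdTail w ^ 2 + w * stdPdf w * stdTail w - stdPdf w ^ 2)
    (f' := fun w => stdPdf w * (w * stdPdf w - (1 + w ^ 2) * stdTail w))
    (fun w => ?_) (fun w => mul_nonpos_of_nonneg_of_nonpos (stdPdf_pos w).le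
      (by linarith [mul_stdPdf_le w])) ?_ w
  · simpa using h
  · convert! (((hasDerivAt_stdTail w).pow 2).add
      (((hasDerivAt_id w).mul (hasDerivAt_stdPdf w)).mul (hasDerivAt_stdTail w))).sub
      ((hasDerivAt_stdPdf w).pow 2) using 1
    simp; ring
  · have := (((tendsto_pow_mul_stdTail 0).pow 2).add
      ((tendsto_pow_mul_stdPdf 0).mul (tendsto_pow_mul_stdTail 1))).sub
      ((tendsto_pow_mul_stdPdf 0).pow 2)
    norm_num at this
    exact this.congr fun x => by ring

/-- This is what makes `|f'| ≤ 1` for the Stein solution. Let `U` be the Mills ratio and `x` the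
positive root of `x² + w x = 1`. Birnbaum's inequality gives `U ≥ x`, so `r = 1 - w U ≤ x²`. The
excesses at `w` and `-w` are `p r` and `p r + w`, and with `p ≤ 1/2` the claim becomes a polynomial
inequality in `x ∈ (0, 1]`. -/
theorem two_mul_stdExcess_mul_le_of_nonneg {w : ℝ} (hw : 0 ≤ w) :
    2 * (stdExcess w * stdExcess (-w)) ≤ stdPdf w := by
  set p := stdPdf w with hp
  have hp0 : 0 < p := stdPdf_pos w
  have hp2 : p ≤ 1 / 2 := stdPdf_le_half w
  set U := stdTail w / p with hU
  have hT : stdTail w = U * p := by rw [hU]; field_simp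
  have hU0 : 0 ≤ U := div_nonneg (stdTail_nonneg w) hp0.le
  have hB : 1 ≤ U ^ 2 + w * U := by
    have := sq_stdPdf_le w
    rw [← hp, hT] at this
    have h2 : p ^ 2 * 1 ≤ p ^ 2 * (U ^ 2 + w * U) := by linarith
    exact le_of_mul_le_mul_left h2 (by positivity)
  obtain ⟨x, hx0, hx1, hxw⟩ : ∃ x : ℝ, 0 < x ∧ x ≤ 1 ∧ x ^ 2 + w * x = 1 := by
    have hs : √(w ^ 2 + 4) ^ 2 = w ^ 2 + 4 := Real.sq_sqrt (by positivity)
    refine ⟨(√(w ^ 2 + 4) - w) / 2, ?_, ?_, by nlinarith⟩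
    · have : w < √(w ^ 2 + 4) := Real.lt_sqrt_of_sq_lt (by linarith)
      linarith
    · have : √(w ^ 2 + 4) ≤ w + 2 := Real.sqrt_le_iff.2 ⟨by linarith, by nlinarith⟩
      linarith
  have hUx : x ≤ U := by
    by_contra h
    push Not at h
    nlinarith
  have hr0 : 0 ≤ 1 - w * U := by
    have := mul_stdTail_le w
    rw [← hp, hT] at this
    have h2 : 0 ≤ p * (1 - w * U) := by linarith
    exact nonneg_of_mul_nonneg_right h2 hp0
  have hrx : 1 - w * U ≤ x ^ 2 := by nlinarith
  have hR : stdExcess w = p * (1 - w * U) := by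
    rw [stdExcess, hT]; ring
  have hwx : w * x ^ 2 = x - x ^ 3 := by nlinarith
  rw [stdExcess_neg, hR]
  set r := 1 - w * U with hr
  have h1 : p * r ≤ r / 2 := by nlinarith
  have h2 : r * (r / 2 + w) ≤ x ^ 2 * (x ^ 2 / 2 + w) := by gcongr
  have h3 : x ^ 2 * (x ^ 2 / 2 + w) ≤ 1 / 2 := by
    -- Since `w x² = x - x³`, the claim is `1 - 2x + 2x³ - x⁴ ≥ 0`, which factors in this way.
    have : 0 ≤ (1 - x) ^ 3 * (1 + x) := mul_nonneg (pow_nonneg (by linarith) 3) (by linarith)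
    nlinarith
  have h4 : r * (p * r + w) ≤ 1 / 2 := by
    have : r * (p * r + w) ≤ r * (r / 2 + w) := by gcongr
    linarith
  nlinarith

theorem two_mul_stdExcess_mul_le (w : ℝ) :
    2 * (stdExcess w * stdExcess (-w)) ≤ stdPdf w := by
  rcases le_total 0 w with hw | hw
  · exact two_mul_stdExcess_mul_le_of_nonneg hw
  · have := two_mul_stdExcess_mul_le_of_nonneg (neg_nonneg.2 hw)
    rw [neg_neg, stdPdf_neg] at this
    linarith

end GaussianTail

/-! ### Stein's equation: explicit solution and bounds. -/

section SteinSolution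

open Set Filter Topology

/-- The integral `∫_w^∞ g(t) P(Z > t) dt` for a standard normal variable `Z`. -/
noncomputable def tailIntegral (g : ℝ → ℝ) (w : ℝ) : ℝ := ∫ t in Ioi w, g t * stdTail t

theorem integrableOn_stdTail (w : ℝ) : IntegrableOn stdTail (Ioi w) := by
  have h := integrableOn_Ioi_deriv_of_nonpos' (a := w) (fun x _ => hasDerivAt_stdExcess x)
    (fun x _ => neg_nonpos.2 (stdTail_nonneg x)) tendsto_stdExcess
  simpa using! h.neg

theorem integral_stdTail (w : ℝ) : ∫ t in Ioi w, stdTail t = stdExcess w := by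
  have h := integral_Ioi_of_hasDerivAt_of_nonpos' (a := w) (fun x _ => hasDerivAt_stdExcess x)
    (fun x _ => neg_nonpos.2 (stdTail_nonneg x)) tendsto_stdExcess
  rw [integral_neg] at h
  linarith

theorem norm_mul_stdTail_le {g : ℝ → ℝ} (hb : ∀ x, |g x| ≤ 1) (t : ℝ) :
    ‖g t * stdTail t‖ ≤ stdTail t := by
  rw [norm_mul, Real.norm_eq_abs, Real.norm_of_nonneg (stdTail_nonneg t)]
  exact mul_le_of_le_one_left (stdTail_nonneg t) (hb t)

theorem abs_tailIntegral_le {g : ℝ → ℝ} (hb : ∀ x, |g x| ≤ 1) (w : ℝ) :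
    |tailIntegral g w| ≤ stdExcess w := by
  rw [← integral_stdTail]
  exact norm_integral_le_of_norm_le (integrableOn_stdTail w)
    (Eventually.of_forall (norm_mul_stdTail_le hb))

theorem hasDerivAt_tailIntegral {g : ℝ → ℝ} (hg : Continuous g) (hb : ∀ x, |g x| ≤ 1) (w : ℝ) :
    HasDerivAt (tailIntegral g) (-(g w * stdTail w)) w :=
  hasDerivAt_integral_Ioi (hg.mul continuous_stdTail) (fun a =>
    (integrableOn_stdTail a).mono' (hg.mul continuous_stdTail).aestronglyMeasurable
      (Eventually.of_forall (norm_mul_stdTail_le hb))) w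

theorem hasDerivAt_tailIntegral_neg {g : ℝ → ℝ} (hg : Continuous g) (hb : ∀ x, |g x| ≤ 1)
    (w : ℝ) :
    HasDerivAt (fun w => tailIntegral (fun t => g (-t)) (-w)) (g w * stdTail (-w)) w := by
  have h := hasDerivAt_tailIntegral (g := fun t => g (-t)) (by fun_prop) (fun x => hb _) (-w)
  convert! h.comp w (hasDerivAt_neg w) using 1
  simp

/-- The solution of the Stein equation for a function with derivative `g`. -/
noncomputable def steinSol (g : ℝ → ℝ) (w : ℝ) : ℝ :=
  -(stdTail w * tailIntegral (fun t => g (-t)) (-w) + stdTail (-w) * tailIntegral g w) / stdPdf w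

/-- The right-hand side of the Stein equation solved by `steinSol g`. -/
noncomputable def steinRhs (g : ℝ → ℝ) (w : ℝ) : ℝ :=
  tailIntegral (fun t => g (-t)) (-w) - tailIntegral g w

theorem hasDerivAt_stdTail_neg (w : ℝ) :
    HasDerivAt (fun w => stdTail (-w)) (stdPdf w) w := by
  convert! (hasDerivAt_stdTail (-w)).comp w (hasDerivAt_neg w) using 1
  simp [stdPdf_neg]

theorem hasDerivAt_steinRhs {g : ℝ → ℝ} (hg : Continuous g) (hb : ∀ x, |g x| ≤ 1) (w : ℝ) :
    HasDerivAt (steinRhs g) (g w) w := by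
  convert! (hasDerivAt_tailIntegral_neg hg hb w).sub (hasDerivAt_tailIntegral hg hb w) using 1
  linear_combination (-g w) * stdTail_add_neg w

theorem hasDerivAt_steinSol {g : ℝ → ℝ} (hg : Continuous g) (hb : ∀ x, |g x| ≤ 1) (w : ℝ) :
    HasDerivAt (steinSol g) (w * steinSol g w + steinRhs g w) w := by
  have hp : stdPdf w ≠ 0 := (stdPdf_pos w).ne'
  convert! (((hasDerivAt_stdTail w).mul (hasDerivAt_tailIntegral_neg hg hb w)).add
    ((hasDerivAt_stdTail_neg w).mul (hasDerivAt_tailIntegral hg hb w))).neg.div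
    (hasDerivAt_stdPdf w) hp using 1
  simp only [steinSol, steinRhs, Pi.neg_apply, Pi.add_apply, Pi.mul_apply]
  field_simp
  ring

theorem hasDerivAt_deriv_steinSol {g : ℝ → ℝ} (hg : Continuous g) (hb : ∀ x, |g x| ≤ 1) (w : ℝ) :
    HasDerivAt (fun w => w * steinSol g w + steinRhs g w)
      (steinSol g w + w * (w * steinSol g w + steinRhs g w) + g w) w := by
  convert! ((hasDerivAt_id w).mul (hasDerivAt_steinSol hg hb w)).add
    (hasDerivAt_steinRhs hg hb w) using 1
  simp

/-- The derivative is a combination of the two tail integrals whose weights are the excesses at `w`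
and `-w`; each integral is bounded by the opposite excess, so both products are the one in
`two_mul_stdExcess_mul_le`. -/
theorem abs_deriv_steinSol_le {g : ℝ → ℝ} (hb : ∀ x, |g x| ≤ 1) (w : ℝ) :
    |w * steinSol g w + steinRhs g w| ≤ 1 := by
  have hp := stdPdf_pos w
  have hI := abs_tailIntegral_le (g := fun t => g (-t)) (fun x => hb _) (-w)
  have hJ := abs_tailIntegral_le hb w
  have h1 := stdExcess_nonneg w
  have h2 := stdExcess_nonneg (-w)
  have hM := two_mul_stdExcess_mul_le w
  have e : w * steinSol g w + steinRhs g w =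
      (stdExcess w * tailIntegral (fun t => g (-t)) (-w)
        - stdExcess (-w) * tailIntegral g w) / stdPdf w := by
    simp only [steinSol, steinRhs, stdExcess, stdPdf_neg]
    field_simp
    ring
  rw [e, abs_div, abs_of_pos hp, div_le_one hp]
  refine (abs_sub _ _).trans ?_
  rw [abs_mul, abs_mul, abs_of_nonneg h1, abs_of_nonneg h2]
  nlinarith [mul_le_mul_of_nonneg_left hI h1, mul_le_mul_of_nonneg_left hJ h2]

/-- Here the weights of the tail integrals are nonnegative by the Mills ratio inequality at `±w`.
Replacing the integrals by their bounds gives exactly the density, so all terms but `g` contribute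
at most 1. -/
theorem abs_deriv_deriv_steinSol_le {g : ℝ → ℝ} (hb : ∀ x, |g x| ≤ 1) (w : ℝ) :
    |steinSol g w + w * (w * steinSol g w + steinRhs g w) + g w| ≤ 2 := by
  have hp := stdPdf_pos w
  have hI := abs_tailIntegral_le (g := fun t => g (-t)) (fun x => hb _) (-w)
  have hJ := abs_tailIntegral_le hb w
  have h1 : 0 ≤ (1 + w ^ 2) * stdTail w - w * stdPdf w := by linarith [mul_stdPdf_le w]
  have h2 : 0 ≤ (1 + w ^ 2) * stdTail (-w) + w * stdPdf w := by
    have := mul_stdPdf_le (-w)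
    rw [stdPdf_neg] at this
    linarith
  have e : steinSol g w + w * (w * steinSol g w + steinRhs g w) =
      -(((1 + w ^ 2) * stdTail w - w * stdPdf w) * tailIntegral (fun t => g (-t)) (-w)
        + ((1 + w ^ 2) * stdTail (-w) + w * stdPdf w) * tailIntegral g w) / stdPdf w := by
    simp only [steinSol, steinRhs]
    field_simp
    ring
  have key : |steinSol g w + w * (w * steinSol g w + steinRhs g w)| ≤ 1 := by
    rw [e, abs_div, abs_of_pos hp, div_le_one hp, abs_neg]
    refine (abs_add_le _ _).trans ?_
    rw [abs_mul, abs_mul, abs_of_nonneg h1, abs_of_nonneg h2]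
    refine (add_le_add (mul_le_mul_of_nonneg_left hI h1)
      (mul_le_mul_of_nonneg_left hJ h2)).trans (le_of_eq ?_)
    simp only [stdExcess, stdPdf_neg]
    linear_combination stdPdf w * stdTail_add_neg w
  linarith [abs_add_le (steinSol g w + w * (w * steinSol g w + steinRhs g w)) (g w), hb w]

theorem norm_sub_le_of_hasDerivAt {f f' : ℝ → ℝ} {L : ℝ} (hf : ∀ x, HasDerivAt f (f' x) x)
    (hL : ∀ x, |f' x| ≤ L) (x y : ℝ) : |f y - f x| ≤ L * |y - x| :=
  convex_univ.norm_image_sub_le_of_norm_hasDerivWithin_le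
    (fun x _ => (hf x).hasDerivWithinAt) (fun x _ => hL x) (mem_univ x) (mem_univ y)

theorem integrable_gaussian_of_hasDerivAt {f f' : ℝ → ℝ} {L : ℝ}
    (hf : ∀ x, HasDerivAt f (f' x) x) (hL : ∀ x, |f' x| ≤ L) :
    Integrable f (gaussianReal 0 1) := by
  have hid : Integrable (fun x : ℝ => x) (gaussianReal 0 1) :=
    (memLp_id_gaussianReal (μ := 0) (v := 1) 1).integrable (by simp)
  have hc : Continuous f := continuous_iff_continuousAt.2 fun x => (hf x).continuousAt
  refine ((hid.norm.const_mul L).add (integrable_const |f 0|)).mono'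
    hc.aestronglyMeasurable (Eventually.of_forall fun x => ?_)
  have := norm_sub_le_of_hasDerivAt hf hL 0 x
  rw [sub_zero] at this
  have h2 := abs_sub_abs_le_abs_sub (f x) (f 0)
  simp only [Pi.add_apply, Real.norm_eq_abs]
  linarith

theorem tendsto_mul_stdPdf_of_abs_le {f : ℝ → ℝ} {a : ℝ} (hf : ∀ x, |f x| ≤ a + |x|) :
    Tendsto (fun x => f x * stdPdf x) atTop (𝓝 0) := by
  have h := ((tendsto_pow_mul_stdPdf 0).const_mul a).add (tendsto_pow_mul_stdPdf 1)
  rw [mul_zero, add_zero] at h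
  refine squeeze_zero_norm' ?_ h
  filter_upwards [eventually_ge_atTop 0] with x hx
  rw [norm_mul, Real.norm_eq_abs, Real.norm_of_nonneg (stdPdf_pos x).le]
  have := hf x
  rw [abs_of_nonneg hx] at this
  nlinarith [stdPdf_pos x]

/-- Stein's equation says that `steinRhs g` times the density is the derivative of `steinSol g`
times the density, and the latter vanishes at `±∞` because `steinSol g` grows at most linearly. -/
theorem integral_steinRhs {g : ℝ → ℝ} (hg : Continuous g) (hb : ∀ x, |g x| ≤ 1) :
    ∫ x, steinRhs g x ∂gaussianReal 0 1 = 0 := by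
  have hint := integrable_gaussian_of_hasDerivAt (hasDerivAt_steinRhs hg hb) hb
  have hlin : ∀ x, |steinSol g x| ≤ |steinSol g 0| + |x| := fun x => by
    have := norm_sub_le_of_hasDerivAt (hasDerivAt_steinSol hg hb) (abs_deriv_steinSol_le hb) 0 x
    rw [sub_zero] at this
    linarith [abs_sub_abs_le_abs_sub (steinSol g x) (steinSol g 0)]
  have hd : ∀ x, HasDerivAt (fun x => steinSol g x * stdPdf x) (stdPdf x * steinRhs g x) x := by
    intro x
    convert! (hasDerivAt_steinSol hg hb x).mul (hasDerivAt_stdPdf x) using 1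
    ring
  have htop := tendsto_mul_stdPdf_of_abs_le hlin
  have hbot : Tendsto (fun x => steinSol g x * stdPdf x) atBot (𝓝 0) := by
    have := (tendsto_mul_stdPdf_of_abs_le (f := fun x => steinSol g (-x))
      (fun x => by simpa using hlin (-x))).comp tendsto_neg_atBot_atTop
    refine this.congr fun x => ?_
    simp [stdPdf_neg]
  rw [integral_gaussianReal_eq_integral_smul one_ne_zero]
  simp only [smul_eq_mul, ← stdPdf_eq]
  rw [integral_of_hasDerivAt_of_tendsto hd ?_ hbot htop, sub_zero]
  have h2 := hint
  rw [gaussianReal_of_var_ne_zero 0 one_ne_zero] at h2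
  have h3 := (integrable_withDensity_iff_integrable_smul'
    (measurable_gaussianPDF 0 1) (Eventually.of_forall fun x => gaussianPDF_lt_top)).1 h2
  refine h3.congr (Eventually.of_forall fun x => ?_)
  simp [stdPdf_eq]

/-- Solution of Stein's equation for a smooth Lipschitz function, with the classical bounds. -/
theorem exists_stein_solution {h g : ℝ → ℝ} (hh : ∀ x, HasDerivAt h (g x) x) (hg : Continuous g)
    (hb : ∀ x, |g x| ≤ 1) :
    ∃ f f' : ℝ → ℝ, (∀ x, HasDerivAt f (f' x) x) ∧ (∀ x, |f' x| ≤ 1) ∧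
      (∀ x y, |f' y - f' x| ≤ 2 * |y - x|) ∧
      ∀ x, f' x - x * f x = h x - ∫ y, h y ∂gaussianReal 0 1 := by
  refine ⟨steinSol g, fun w => w * steinSol g w + steinRhs g w, hasDerivAt_steinSol hg hb,
    abs_deriv_steinSol_le hb, norm_sub_le_of_hasDerivAt (hasDerivAt_deriv_steinSol hg hb)
      (abs_deriv_deriv_steinSol_le hb), fun x => ?_⟩
  -- The difference is constant; integrating it against the normal law identifies the constant as
  -- the mean of `h`.
  have hd : ∀ x, HasDerivAt (fun x => h x - steinRhs g x) 0 x := fun x => by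
    simpa using! (hh x).sub (hasDerivAt_steinRhs hg hb x)
  have hconst : ∀ y, h y - steinRhs g y = h x - steinRhs g x := fun y =>
    is_const_of_deriv_eq_zero (fun x => (hd x).differentiableAt) (fun x => (hd x).deriv) y x
  have h1 : ∫ y, (h y - steinRhs g y) ∂gaussianReal 0 1 = h x - steinRhs g x := by
    simp [hconst]
  rw [integral_sub (integrable_gaussian_of_hasDerivAt hh hb)
    (integrable_gaussian_of_hasDerivAt (hasDerivAt_steinRhs hg hb) hb),
    integral_steinRhs hg hb] at h1
  linarith

end SteinSolution

/-! ### Reduction of the Wasserstein distance to Stein's equation. -/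

section Wasserstein

open Set Filter Topology

/-- The moving average `ε⁻¹ ∫_x^{x+ε} h` works: its derivative is a difference quotient of `h`. -/
theorem exists_smooth_approx {h : ℝ → ℝ} (hh : LipschitzWith 1 h) {ε : ℝ} (hε : 0 < ε) :
    ∃ H g : ℝ → ℝ, (∀ x, HasDerivAt H (g x) x) ∧ Continuous g ∧ (∀ x, |g x| ≤ 1) ∧
      ∀ x, |H x - h x| ≤ ε := by
  have hc := hh.continuous
  have hlip : ∀ x y, |h x - h y| ≤ |x - y| := fun x y => by
    simpa [Real.dist_eq] using hh.dist_le_mul x y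
  have hF : ∀ x, HasDerivAt (fun u => ∫ t in (0 : ℝ)..u, h t) (h x) x := fun x =>
    intervalIntegral.integral_hasDerivAt_right (hc.intervalIntegrable 0 x)
      hc.stronglyMeasurable.stronglyMeasurableAtFilter hc.continuousAt
  refine ⟨fun x => ε⁻¹ * ((∫ t in (0 : ℝ)..(x + ε), h t) - ∫ t in (0 : ℝ)..x, h t),
    fun x => ε⁻¹ * (h (x + ε) - h x), fun x => ?_, by fun_prop, fun x => ?_, fun x => ?_⟩
  · exact (((hF (x + ε)).comp_add_const x ε).sub (hF x)).const_mul ε⁻¹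
  · have := hlip (x + ε) x
    rw [add_sub_cancel_left, abs_of_pos hε] at this
    rw [abs_mul, abs_of_pos (inv_pos.2 hε), inv_mul_le_iff₀ hε, mul_one]
    exact this
  · beta_reduce
    rw [intervalIntegral.integral_interval_sub_left (hc.intervalIntegrable _ _)
      (hc.intervalIntegrable _ _)]
    have h1 : ∫ t in x..(x + ε), (h t - h x) = (∫ t in x..(x + ε), h t) - ε * h x := by
      rw [intervalIntegral.integral_sub (hc.intervalIntegrable _ _) (by simp)]
      simp
    have h2 : ‖∫ t in x..(x + ε), (h t - h x)‖ ≤ ε * |x + ε - x| := by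
      refine intervalIntegral.norm_integral_le_of_norm_le_const fun t ht => ?_
      rw [uIoc_of_le (by linarith)] at ht
      refine (hlip t x).trans ?_
      rw [abs_of_pos (by linarith [ht.1])]
      linarith [ht.2]
    rw [add_sub_cancel_left, abs_of_pos hε, h1, Real.norm_eq_abs] at h2
    have h3 : ε⁻¹ * (∫ t in x..(x + ε), h t) - h x
        = ε⁻¹ * ((∫ t in x..(x + ε), h t) - ε * h x) := by field_simp
    rw [h3, abs_mul, abs_of_pos (inv_pos.2 hε), inv_mul_le_iff₀ hε]
    exact h2

theorem integrable_of_lipschitz {h : ℝ → ℝ} (hh : LipschitzWith 1 h) {μ : Measure ℝ}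
    [IsProbabilityMeasure μ] (hμ : Integrable (fun x => x) μ) : Integrable h μ := by
  refine (hμ.norm.add (integrable_const |h 0|)).mono' hh.continuous.aestronglyMeasurable
    (Eventually.of_forall fun x => ?_)
  have := hh.dist_le_mul x 0
  simp only [Real.dist_eq, NNReal.coe_one, one_mul, sub_zero] at this
  simp only [Pi.add_apply, Real.norm_eq_abs]
  linarith [abs_sub_abs_le_abs_sub (h x) (h 0)]

/-- Stein's method for the Wasserstein distance to the standard normal law. -/
theorem wassersteinDist_gaussian_le {μ : Measure ℝ} [IsProbabilityMeasure μ]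
    (hμ : Integrable (fun x => x) μ) {C : ℝ}
    (H : ∀ f f' : ℝ → ℝ, (∀ x, HasDerivAt f (f' x) x) → (∀ x, |f' x| ≤ 1) →
      (∀ x y, |f' y - f' x| ≤ 2 * |y - x|) → |∫ x, (f' x - x * f x) ∂μ| ≤ C) :
    wassersteinDist μ (gaussianReal 0 1) ≤ ENNReal.ofReal C := by
  refine iSup₂_le fun h hh => ENNReal.ofReal_le_ofReal (le_of_forall_pos_le_add fun δ hδ => ?_)
  obtain ⟨K, g, hK, hg, hb, hKh⟩ := exists_smooth_approx hh (half_pos hδ)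
  have hid : Integrable (fun x : ℝ => x) (gaussianReal 0 1) :=
    (memLp_id_gaussianReal (μ := 0) (v := 1) 1).integrable (by simp)
  have hKc : Continuous K := continuous_iff_continuousAt.2 fun x => (hK x).continuousAt
  -- Used for `μ` and for the normal law; smoothing costs `δ / 2` in each.
  have key : ∀ ν : Measure ℝ, IsProbabilityMeasure ν → Integrable (fun x => x) ν →
      Integrable K ν ∧ |∫ x, K x ∂ν - ∫ x, h x ∂ν| ≤ δ / 2 := by
    intro ν _ hν
    have hi := integrable_of_lipschitz hh hν
    have hKi : Integrable K ν := by
      have h1 : Integrable (fun x => K x - h x) ν :=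
        (integrable_const (δ / 2)).mono' (hKc.sub hh.continuous).aestronglyMeasurable
          (Eventually.of_forall hKh)
      exact (h1.add hi).congr (Eventually.of_forall fun x => sub_add_cancel _ _)
    refine ⟨hKi, ?_⟩
    rw [← integral_sub hKi hi]
    simpa using norm_integral_le_of_norm_le_const (μ := ν) (f := fun x => K x - h x)
      (Eventually.of_forall hKh)
  obtain ⟨f, f', hf, hf1, hf2, hs⟩ := exists_stein_solution hK hg hb
  have h1 := H f f' hf hf1 hf2
  simp only [hs] at h1
  rw [integral_sub (key μ inferInstance hμ).1 (integrable_const _)] at h1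
  simp only [integral_const, probReal_univ, one_smul] at h1
  have h2 := abs_le.1 (key μ inferInstance hμ).2
  have h3 := abs_le.1 (key _ inferInstance hid).2
  have h4 := abs_le.1 h1
  rw [abs_le]
  constructor <;> linarith [h2.1, h2.2, h3.1, h3.2, h4.1, h4.2]

end Wasserstein

/-! ### Taylor and moment inequalities; the zero-bias discrepancy of a law with given fourth moment.
-/

section Discrepancy

open Set Filter Topology

/-- As `φ'` is only Lipschitz, the second-order bound comes from monotonicity: along the segment
from `x` to `y`, the remainder minus its quadratic bound is nonincreasing in the parameter. -/
theorem sub_sub_deriv_mul_le {φ φ' : ℝ → ℝ} {L : ℝ} (hφ : ∀ x, HasDerivAt φ (φ' x) x)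
    (hL : ∀ x y, |φ' y - φ' x| ≤ L * |y - x|) (x y : ℝ) :
    φ y - φ x - φ' x * (y - x) ≤ L * (y - x) ^ 2 / 2 := by
  set d := y - x with hd
  set G : ℝ → ℝ := fun u => φ (x + u * d) - φ' x * (u * d) - L * d ^ 2 * (u ^ 2 / 2) with hG
  have hder : ∀ u, HasDerivAt G (φ' (x + u * d) * d - φ' x * d - L * d ^ 2 * u) u := by
    intro u
    have h1 : HasDerivAt (fun u : ℝ => x + u * d) d u := by
      simpa using ((hasDerivAt_id u).mul_const d).const_add x
    have h2 : HasDerivAt (fun u : ℝ => φ' x * (u * d)) (φ' x * d) u := by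
      simpa using ((hasDerivAt_id u).mul_const d).const_mul (φ' x)
    have h3 : HasDerivAt (fun u : ℝ => L * d ^ 2 * (u ^ 2 / 2)) (L * d ^ 2 * u) u := by
      convert! ((hasDerivAt_pow 2 u).div_const 2).const_mul (L * d ^ 2) using 1
      simp
    exact (((hφ _).comp u h1).sub h2).sub h3
  have hanti : AntitoneOn G (Ici 0) := by
    refine antitoneOn_of_deriv_nonpos (convex_Ici 0)
      (fun u _ => (hder u).continuousAt.continuousWithinAt)
      (fun u _ => (hder u).differentiableAt.differentiableWithinAt) fun u hu => ?_
    rw [interior_Ici] at hu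
    rw [(hder u).deriv]
    have h1 := hL x (x + u * d)
    rw [add_sub_cancel_left, abs_mul, abs_of_pos (show 0 < u from hu)] at h1
    have h2 : (φ' (x + u * d) - φ' x) * d ≤ L * (u * |d|) * |d| :=
      (le_abs_self _).trans (by rw [abs_mul]; gcongr)
    have h3 : |d| * |d| = d ^ 2 := by rw [← sq, sq_abs]
    have h4 : L * (u * |d|) * |d| = L * d ^ 2 * u := by linear_combination (L * u) * h3
    linarith
  have h := hanti (mem_Ici.2 le_rfl) (mem_Ici.2 zero_le_one) zero_le_one
  simp only [hG, one_mul, zero_mul, add_zero, hd, add_sub_cancel] at h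
  rw [← hd] at h
  linarith

theorem abs_sub_sub_deriv_mul_le {φ φ' : ℝ → ℝ} {L : ℝ} (hφ : ∀ x, HasDerivAt φ (φ' x) x)
    (hL : ∀ x y, |φ' y - φ' x| ≤ L * |y - x|) (x y : ℝ) :
    |φ y - φ x - φ' x * (y - x)| ≤ L * (y - x) ^ 2 / 2 := by
  refine abs_le.2 ⟨?_, sub_sub_deriv_mul_le hφ hL x y⟩
  have := sub_sub_deriv_mul_le (φ := fun x => -φ x) (φ' := fun x => -φ' x)
    (fun x => (hφ x).neg) (fun x y => by rw [← neg_sub', abs_neg]; exact hL x y) x y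
  linarith

theorem sq_integral_mul_le {α : Type*} [MeasurableSpace α] {μ : Measure α} {f g : α → ℝ}
    (hf : Integrable (fun x => f x ^ 2) μ) (hg : Integrable (fun x => g x ^ 2) μ)
    (hfg : Integrable (fun x => f x * g x) μ) :
    (∫ x, f x * g x ∂μ) ^ 2 ≤ (∫ x, f x ^ 2 ∂μ) * ∫ x, g x ^ 2 ∂μ := by
  have h : ∀ t : ℝ, 0 ≤ (∫ x, f x ^ 2 ∂μ) * (t * t) + (2 * ∫ x, f x * g x ∂μ) * t
      + ∫ x, g x ^ 2 ∂μ := by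
    intro t
    have h0 : 0 ≤ ∫ x, (t * f x + g x) ^ 2 ∂μ := integral_nonneg fun x => sq_nonneg _
    have e : ∀ x, (t * f x + g x) ^ 2 = t * t * f x ^ 2 + (2 * t * (f x * g x) + g x ^ 2) :=
      fun x => by ring
    simp only [e] at h0
    rw [integral_add (hf.const_mul _) ((hfg.const_mul _).fun_add hg),
      integral_add (hfg.const_mul _) hg, integral_const_mul, integral_const_mul] at h0
    linarith
  have := discrim_le_zero h
  rw [discrim] at this
  linarith

theorem integral_mul_le_sqrt {α : Type*} [MeasurableSpace α] {μ : Measure α} {f g : α → ℝ}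
    (hf : Integrable (fun x => f x ^ 2) μ) (hg : Integrable (fun x => g x ^ 2) μ)
    (hfg : Integrable (fun x => f x * g x) μ) :
    ∫ x, f x * g x ∂μ ≤ √((∫ x, f x ^ 2 ∂μ) * ∫ x, g x ^ 2 ∂μ) :=
  Real.le_sqrt_of_sq_le (sq_integral_mul_le hf hg hfg)

theorem abs_pow_le_one_add_pow_four {k : ℕ} (hk : k ≤ 4) (x : ℝ) : |x| ^ k ≤ 1 + x ^ 4 := by
  have h4 : x ^ 4 = |x| ^ 4 := by rw [← abs_pow, abs_of_nonneg (by positivity)]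
  rcases le_total |x| 1 with h | h
  · have := pow_le_one₀ (n := k) (abs_nonneg x) h
    nlinarith [sq_nonneg (x ^ 2)]
  · have := pow_le_pow_right₀ h hk
    linarith

theorem integrable_abs_pow_of_pow_four {α : Type*} [MeasurableSpace α] {μ : Measure α}
    [IsFiniteMeasure μ] {f : α → ℝ} (hf : AEStronglyMeasurable f μ)
    (h4 : Integrable (fun x => f x ^ 4) μ) {k : ℕ} (hk : k ≤ 4) :
    Integrable (fun x => |f x| ^ k) μ := by
  refine ((integrable_const (1 : ℝ)).add h4).mono' (hf.norm.pow k)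
    (Eventually.of_forall fun x => ?_)
  rw [Real.norm_of_nonneg (by positivity)]
  exact abs_pow_le_one_add_pow_four hk (f x)

theorem integrable_pow_of_pow_four {α : Type*} [MeasurableSpace α] {μ : Measure α}
    [IsFiniteMeasure μ] {f : α → ℝ} (hf : AEStronglyMeasurable f μ)
    (h4 : Integrable (fun x => f x ^ 4) μ) {k : ℕ} (hk : k ≤ 4) :
    Integrable (fun x => f x ^ k) μ := by
  refine (integrable_abs_pow_of_pow_four hf h4 hk).mono' (hf.pow k)
    (Eventually.of_forall fun x => ?_)
  simp

theorem integral_abs_pow_three_le {α : Type*} [MeasurableSpace α] {μ : Measure α}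
    [IsFiniteMeasure μ] {f : α → ℝ} (hf : AEStronglyMeasurable f μ)
    (h4 : Integrable (fun x => f x ^ 4) μ) :
    ∫ x, |f x| ^ 3 ∂μ ≤ √((∫ x, f x ^ 2 ∂μ) * ∫ x, f x ^ 4 ∂μ) := by
  have e : ∀ x, |f x| ^ 3 = |f x| * f x ^ 2 := fun x => by rw [← sq_abs (f x)]; ring
  have h3 := integrable_abs_pow_of_pow_four hf h4 (k := 3) (by norm_num)
  simp only [e] at h3 ⊢
  have h2 := integrable_pow_of_pow_four hf h4 (k := 2) (by norm_num)
  have h := integral_mul_le_sqrt (f := fun x => |f x|) (g := fun x => f x ^ 2)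
    (by simpa using h2) (by simpa [← pow_mul] using h4) h3
  simpa [← pow_mul] using h

/-- A bound for the distance between a centred law with unit variance and its zero-bias law, in
terms of the fourth moment `m`. -/
noncomputable def zeroBiasBound (m : ℝ) : ℝ := 101 / 400 * √m + √(81 / 400 * m + 1 / 10)

/-- Expand `φ` at the intermediate point `t x` both from 0 and from `x`, with `t = 11/20`. The two
quadratic remainders give `(t² + (1 - t)²)/2 = 101/400`, and the leftover multiple of `φ' x - φ' 0`
is `(1 - t) x² - 1`. In `two_mul_zeroBiasBound_sq_le`, `m → ∞` forces `(1 - t)² ≤ 1/√2 - 1/2` (`t`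
above about 0.545) and `m = 1` forces `t² ≤ √(2/3) - 1/2` (`t` below about 0.563); the midpoint
would fail. -/
theorem abs_zeroBias_remainder_le {φ φ' : ℝ → ℝ} {L : ℝ} (hφ : ∀ x, HasDerivAt φ (φ' x) x)
    (hL : ∀ x y, |φ' y - φ' x| ≤ L * |y - x|) (x : ℝ) :
    |x * φ x - φ' x - φ 0 * x - φ' 0 * (x ^ 2 - 1)|
      ≤ L * (101 / 400 * |x| ^ 3 + |9 / 20 * x ^ 2 - 1| * |x|) := by
  have h1 := abs_sub_sub_deriv_mul_le hφ hL 0 (11 / 20 * x)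
  have h2 := abs_sub_sub_deriv_mul_le hφ hL x (11 / 20 * x)
  have h3 := hL 0 x
  rw [sub_zero] at h3
  have e : x * φ x - φ' x - φ 0 * x - φ' 0 * (x ^ 2 - 1) =
      x * (φ (11 / 20 * x) - φ 0 - φ' 0 * (11 / 20 * x - 0))
      - x * (φ (11 / 20 * x) - φ x - φ' x * (11 / 20 * x - x))
      + (9 / 20 * x ^ 2 - 1) * (φ' x - φ' 0) := by ring
  have hx : x ^ 2 = |x| ^ 2 := (sq_abs x).symm
  rw [e]
  calc _ ≤ |x| * (L * (11 / 20 * x - 0) ^ 2 / 2) + |x| * (L * (11 / 20 * x - x) ^ 2 / 2)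
        + |9 / 20 * x ^ 2 - 1| * (L * |x|) := by
        refine (abs_add_le _ _).trans (add_le_add ((abs_sub _ _).trans (add_le_add ?_ ?_)) ?_) <;>
        · rw [abs_mul]; gcongr
    _ = |x| * (L * (101 / 400 * x ^ 2)) + |9 / 20 * x ^ 2 - 1| * (L * |x|) := by ring
    _ = _ := by rw [hx]; ring

theorem abs_integral_mul_sub_deriv_le {μ : Measure ℝ} [IsProbabilityMeasure μ]
    (h4 : Integrable (fun x => x ^ 4) μ) (hmean : ∫ x, x ∂μ = 0) (hvar : ∫ x, x ^ 2 ∂μ = 1)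
    {φ φ' : ℝ → ℝ} {L : ℝ} (hφ : ∀ x, HasDerivAt φ (φ' x) x)
    (hL : ∀ x y, |φ' y - φ' x| ≤ L * |y - x|) (hL0 : 0 ≤ L) (hc' : Continuous φ') :
    |∫ x, (x * φ x - φ' x) ∂μ| ≤ L * zeroBiasBound (∫ x, x ^ 4 ∂μ) := by
  have hid : AEStronglyMeasurable (fun x : ℝ => x) μ := aestronglyMeasurable_id
  have hc : Continuous φ := continuous_iff_continuousAt.2 fun x => (hφ x).continuousAt
  have i1 : Integrable (fun x : ℝ => x) μ := by
    simpa using integrable_pow_of_pow_four hid h4 (k := 1) (by norm_num)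
  have i2 := integrable_pow_of_pow_four hid h4 (k := 2) (by norm_num)
  have i3 := integrable_abs_pow_of_pow_four hid h4 (k := 3) (by norm_num)
  have iq : Integrable (fun x : ℝ => (9 / 20 * x ^ 2 - 1) ^ 2) μ := by
    have : Integrable (fun x : ℝ => 81 / 400 * x ^ 4 - 9 / 10 * x ^ 2 + 1) μ :=
      ((h4.const_mul _).sub (i2.const_mul _)).add (integrable_const _)
    exact this.congr (Eventually.of_forall fun x => by ring)
  have vq : ∫ x : ℝ, (9 / 20 * x ^ 2 - 1) ^ 2 ∂μ = 81 / 400 * ∫ x, x ^ 4 ∂μ + 1 / 10 := by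
    have e : ∀ x : ℝ, (9 / 20 * x ^ 2 - 1) ^ 2 = 81 / 400 * x ^ 4 - 9 / 10 * x ^ 2 + 1 :=
      fun x => by ring
    simp only [e]
    have i : Integrable (fun x : ℝ => 81 / 400 * x ^ 4 - 9 / 10 * x ^ 2) μ :=
      (h4.const_mul _).sub (i2.const_mul _)
    rw [integral_add i (integrable_const _),
      integral_sub (h4.const_mul _) (i2.const_mul _), integral_const_mul, integral_const_mul, hvar]
    simp; ring
  have ip : Integrable (fun x : ℝ => |9 / 20 * x ^ 2 - 1| * |x|) μ := by
    refine (i3.const_mul (9 / 20)).add i1.norm |>.mono' (by fun_prop)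
      (Eventually.of_forall fun x => ?_)
    rw [norm_mul, norm_abs_eq_norm, norm_abs_eq_norm]
    simp only [Pi.add_apply, Real.norm_eq_abs]
    have : |9 / 20 * x ^ 2 - 1| ≤ 9 / 20 * |x| ^ 2 + 1 := by
      refine (abs_sub _ _).trans (le_of_eq ?_)
      rw [sq_abs, abs_one, abs_of_nonneg (by positivity)]
    calc _ ≤ (9 / 20 * |x| ^ 2 + 1) * |x| := by gcongr
      _ = _ := by ring
  -- The subtracted terms integrate to 0 because the law has mean 0 and variance 1.
  set r : ℝ → ℝ := fun x => x * φ x - φ' x - φ 0 * x - φ' 0 * (x ^ 2 - 1) with hr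
  have hb := abs_zeroBias_remainder_le hφ hL
  have ib : Integrable (fun x : ℝ => L * (101 / 400 * |x| ^ 3 + |9 / 20 * x ^ 2 - 1| * |x|)) μ :=
    ((i3.const_mul _).add ip).const_mul L
  have ir : Integrable r μ := ib.mono' (by fun_prop) (Eventually.of_forall hb)
  have e1 : ∫ x, (x * φ x - φ' x) ∂μ = ∫ x, r x ∂μ := by
    have e : ∀ x, x * φ x - φ' x = r x + (φ 0 * x + φ' 0 * (x ^ 2 - 1)) := fun x => by
      simp only [hr]; ring
    simp only [e]
    have j1 : Integrable (fun x : ℝ => φ' 0 * (x ^ 2 - 1)) μ :=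
      (i2.sub (integrable_const _)).const_mul _
    rw [integral_add ir ((i1.const_mul _).fun_add j1), integral_add (i1.const_mul _) j1,
      integral_const_mul, integral_const_mul, integral_sub i2 (integrable_const _), hmean, hvar]
    simp
  rw [e1]
  refine (norm_integral_le_of_norm_le (f := r) ib (Eventually.of_forall hb)).trans ?_
  rw [integral_const_mul, integral_add (i3.const_mul _) ip, integral_const_mul]
  have b3 := integral_abs_pow_three_le hid h4
  rw [hvar, one_mul] at b3
  have bp := integral_mul_le_sqrt (μ := μ) (f := fun x : ℝ => |9 / 20 * x ^ 2 - 1|)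
    (g := fun x : ℝ => |x|) (by simpa only [sq_abs] using iq) (by simpa only [sq_abs] using i2) ip
  simp only [sq_abs] at bp
  rw [hvar, mul_one, vq] at bp
  unfold zeroBiasBound
  gcongr

/-- The cross term `s t` is handled by a weighted AM–GM. The ratio `t / s` decreases from `11/20` at
`m = 1` to `9/20` as `m → ∞`, which dictates the weight in each case. -/
theorem two_mul_zeroBiasBound_sq_le {m : ℝ} (hm : 1 ≤ m) :
    2 * max m 3 * zeroBiasBound m ^ 2 ≤ m * (m + 3) := by
  have h1 : √m ^ 2 = m := Real.sq_sqrt (by linarith)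
  have h2 : √(81 / 400 * m + 1 / 10) ^ 2 = 81 / 400 * m + 1 / 10 := Real.sq_sqrt (by linarith)
  unfold zeroBiasBound
  set s := √m
  set t := √(81 / 400 * m + 1 / 10)
  rcases le_total m 3 with h | h
  · rw [max_eq_right h]
    have ht : (101 / 400 * s + t) ^ 2 ≤ 2 / 3 * m := by
      nlinarith [sq_nonneg (t - 11 / 20 * s)]
    nlinarith
  · rw [max_eq_left h]
    have ht : (101 / 400 * s + t) ^ 2 ≤ (m + 3) / 2 := by
      nlinarith [sq_nonneg (t - 9 / 20 * s)]
    nlinarith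

end Discrepancy

/-! ### Mixed moments up to order four of an independent sample. -/

section Moments

open Set Filter Topology

/-- A finite family of independent real random variables with mean `0`, variance `1` and fourth
moment `m`. -/
structure IsStdSample {Ω ι : Type*} [MeasurableSpace Ω] (P : Measure Ω) (X : ι → Ω → ℝ) (m : ℝ) :
    Prop where
  measurable : ∀ i, Measurable (X i)
  indep : iIndepFun X P
  mean : ∀ i, ∫ ω, X i ω ∂P = 0
  var : ∀ i, ∫ ω, X i ω ^ 2 ∂P = 1
  integrable_pow_four : ∀ i, Integrable (fun ω => X i ω ^ 4) P
  fourth : ∀ i, ∫ ω, X i ω ^ 4 ∂P = m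

/-- The quadratic form `∑_{k,l} B_{k,l} X_k X_l` of a finite family. -/
def quadSum {Ω ι : Type*} [Fintype ι] (B : ι → ι → ℝ) (X : ι → Ω → ℝ) (ω : Ω) : ℝ :=
  ∑ k, ∑ l, B k l * (X k ω * X l ω)

/-- The linear form `∑_l b_l X_l` of a finite family. -/
def linSum {Ω ι : Type*} [Fintype ι] (b : ι → ℝ) (X : ι → Ω → ℝ) (ω : Ω) : ℝ :=
  ∑ l, b l * X l ω

theorem abs_mul_mul_mul_le (a b c d : ℝ) :
    |a * b * (c * d)| ≤ a ^ 4 + b ^ 4 + (c ^ 4 + d ^ 4) := by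
  refine abs_le.2 ⟨?_, ?_⟩
  · nlinarith [sq_nonneg (a * b + c * d), sq_nonneg (a ^ 2 - b ^ 2), sq_nonneg (c ^ 2 - d ^ 2),
      sq_nonneg (a ^ 2), sq_nonneg (b ^ 2), sq_nonneg (c ^ 2), sq_nonneg (d ^ 2)]
  · nlinarith [sq_nonneg (a * b - c * d), sq_nonneg (a ^ 2 - b ^ 2), sq_nonneg (c ^ 2 - d ^ 2),
      sq_nonneg (a ^ 2), sq_nonneg (b ^ 2), sq_nonneg (c ^ 2), sq_nonneg (d ^ 2)]

theorem linSum_sq {Ω ι : Type*} [Fintype ι] (b : ι → ℝ) (X : ι → Ω → ℝ) (ω : Ω) :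
    linSum b X ω ^ 2 = quadSum (fun k l => b k * b l) X ω := by
  rw [linSum, quadSum, sq, Finset.sum_mul_sum]
  exact Finset.sum_congr rfl fun k _ => Finset.sum_congr rfl fun l _ => by ring

theorem quadSum_sq {Ω ι : Type*} [Fintype ι] (B : ι → ι → ℝ) (X : ι → Ω → ℝ) (ω : Ω) :
    quadSum B X ω ^ 2 = ∑ k, ∑ l, ∑ i, ∑ j,
      B k l * B i j * (X k ω * X l ω * (X i ω * X j ω)) := by
  rw [quadSum, sq, Finset.sum_mul]
  refine Finset.sum_congr rfl fun k _ => ?_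
  rw [Finset.sum_mul]
  refine Finset.sum_congr rfl fun l _ => ?_
  rw [Finset.mul_sum]
  refine Finset.sum_congr rfl fun i _ => ?_
  rw [Finset.mul_sum]
  exact Finset.sum_congr rfl fun j _ => by ring

namespace IsStdSample

variable {Ω ι : Type*} [MeasurableSpace Ω] {P : Measure Ω} [IsProbabilityMeasure P]
  {X : ι → Ω → ℝ} {m : ℝ}

theorem one_le (h : IsStdSample P X m) (i : ι) : 1 ≤ m := by
  have i2 := integrable_pow_of_pow_four (h.measurable i).aestronglyMeasurable
    (h.integrable_pow_four i) (k := 2) (by norm_num)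
  have := sq_integral_mul_le (μ := P) (f := fun ω => X i ω ^ 2) (g := fun _ => 1)
    (by simpa [← pow_mul] using h.integrable_pow_four i) (by simp) (by simpa using i2)
  simpa [← pow_mul, h.var i, h.fourth i] using this

theorem integrable_four (h : IsStdSample P X m) (k l i j : ι) :
    Integrable (fun ω => X k ω * X l ω * (X i ω * X j ω)) P := by
  refine (((h.integrable_pow_four k).add (h.integrable_pow_four l)).add
    ((h.integrable_pow_four i).add (h.integrable_pow_four j))).mono'
    ((((h.measurable k).mul (h.measurable l)).mul
      ((h.measurable i).mul (h.measurable j))).aestronglyMeasurable)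
    (Eventually.of_forall fun ω => abs_mul_mul_mul_le _ _ _ _)

theorem integrable_two (h : IsStdSample P X m) (k l : ι) :
    Integrable (fun ω => X k ω * X l ω) P := by
  have hi := fun i => integrable_pow_of_pow_four (h.measurable i).aestronglyMeasurable
    (h.integrable_pow_four i) (k := 2) (by norm_num)
  refine ((hi k).add (hi l)).mono' ((h.measurable k).mul (h.measurable l)).aestronglyMeasurable
    (Eventually.of_forall fun ω => abs_le.2 ⟨?_, ?_⟩) <;> simp only [Pi.add_apply]
  · nlinarith [sq_nonneg (X k ω + X l ω), sq_nonneg (X k ω), sq_nonneg (X l ω)]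
  · nlinarith [sq_nonneg (X k ω - X l ω), sq_nonneg (X k ω), sq_nonneg (X l ω)]

variable [DecidableEq ι]

theorem integral_mul (h : IsStdSample P X m) (k l : ι) :
    ∫ ω, X k ω * X l ω ∂P = if k = l then 1 else 0 := by
  split_ifs with hkl
  · subst hkl
    simpa [sq] using h.var k
  · rw [(h.indep.indepFun hkl).integral_fun_mul_eq_mul_integral
      (h.measurable k).aestronglyMeasurable (h.measurable l).aestronglyMeasurable, h.mean k,
      zero_mul]

theorem integral_sq_mul_sq (h : IsStdSample P X m) {k l : ι} (hkl : k ≠ l) :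
    ∫ ω, X k ω ^ 2 * X l ω ^ 2 ∂P = 1 := by
  have hi : IndepFun (fun ω => X k ω ^ 2) (fun ω => X l ω ^ 2) P :=
    (h.indep.indepFun hkl).comp (φ := fun x : ℝ => x ^ 2) (ψ := fun x : ℝ => x ^ 2)
      (by fun_prop) (by fun_prop)
  rw [hi.integral_fun_mul_eq_mul_integral ((h.measurable k).pow_const 2).aestronglyMeasurable
    ((h.measurable l).pow_const 2).aestronglyMeasurable, h.var k, h.var l, mul_one]

/-- An index that occurs only once kills the expectation, whatever coincidences hold among `b`, `c`,
`d`. -/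
theorem integral_isolated (h : IsStdSample P X m) {a b c d : ι} (hb : a ≠ b) (hc : a ≠ c)
    (hd : a ≠ d) : ∫ ω, X a ω * (X b ω * X c ω * X d ω) ∂P = 0 := by
  have hdisj : Disjoint ({a} : Finset ι) {b, c, d} := by simp [hb, hc, hd]
  have hi := h.indep.indepFun_finset {a} {b, c, d} hdisj h.measurable
  have hi2 : IndepFun (X a) (fun ω => X b ω * X c ω * X d ω) P :=
    hi.comp (φ := fun g : (({a} : Finset ι) → ℝ) => g ⟨a, by simp⟩)
      (ψ := fun g : (({b, c, d} : Finset ι) → ℝ) =>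
        g ⟨b, by simp⟩ * g ⟨c, by simp⟩ * g ⟨d, by simp⟩) (by fun_prop) (by fun_prop)
  rw [hi2.integral_fun_mul_eq_mul_integral (h.measurable a).aestronglyMeasurable
    (((h.measurable b).mul (h.measurable c)).mul (h.measurable d)).aestronglyMeasurable,
    h.mean a, zero_mul]

/-- Wick's formula with a correction: when all four indices agree, the three pairings count 3
instead of `m`. -/
theorem integral_mul_four (h : IsStdSample P X m) (k l i j : ι) :
    ∫ ω, X k ω * X l ω * (X i ω * X j ω) ∂P =
      (if k = l then if i = j then 1 else 0 else 0) + (if k = i then if l = j then 1 else 0 else 0)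
      + (if k = j then if l = i then 1 else 0 else 0)
      + (if k = l then if k = i then if k = j then m - 3 else 0 else 0 else 0) := by
  have iso : ∀ {a b c d : ι}, a ≠ b → a ≠ c → a ≠ d →
      (∀ ω, X k ω * X l ω * (X i ω * X j ω) = X a ω * (X b ω * X c ω * X d ω)) →
      ∫ ω, X k ω * X l ω * (X i ω * X j ω) ∂P = 0 := fun hb hc hd e => by
    simp only [e]; exact h.integral_isolated hb hc hd
  have pair : ∀ {a b : ι}, a ≠ b →
      (∀ ω, X k ω * X l ω * (X i ω * X j ω) = X a ω ^ 2 * X b ω ^ 2) →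
      ∫ ω, X k ω * X l ω * (X i ω * X j ω) ∂P = 1 := fun hab e => by
    simp only [e]; exact h.integral_sq_mul_sq hab
  by_cases hkl : k = l
  · subst hkl
    by_cases hij : i = j
    · subst hij
      by_cases hki : k = i
      · subst hki
        have e : ∀ ω, X k ω * X k ω * (X k ω * X k ω) = X k ω ^ 4 := fun ω => by ring
        simp only [e, h.fourth k, if_true]
        ring
      · rw [pair hki fun ω => by ring]
        simp [hki]
    · by_cases hki : k = i
      · subst hki
        rw [iso (a := j) (b := k) (c := k) (d := k) (Ne.symm hij) (Ne.symm hij) (Ne.symm hij)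
          fun ω => by ring]
        simp [hij]
      · rw [iso (a := i) (b := j) (c := k) (d := k) hij (Ne.symm hki) (Ne.symm hki)
          fun ω => by ring]
        simp [hij, hki]
  · by_cases hki : k = i
    · subst hki
      by_cases hlj : l = j
      · subst hlj
        rw [pair hkl fun ω => by ring]
        simp [hkl]
      · rw [iso (a := l) (b := k) (c := k) (d := j) (Ne.symm hkl) (Ne.symm hkl) hlj
          fun ω => by ring]
        simp [hkl, hlj, Ne.symm hkl]
    · by_cases hkj : k = j
      · subst hkj
        by_cases hli : l = i
        · subst hli
          rw [pair hkl fun ω => by ring]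
          simp [hkl]
        · rw [iso (a := l) (b := k) (c := i) (d := k) (Ne.symm hkl) hli (Ne.symm hkl)
            fun ω => by ring]
          simp [hkl, hli, hki]
      · rw [iso (a := k) (b := l) (c := i) (d := j) hkl hki hkj fun ω => by ring]
        simp [hkl, hki, hkj]

variable [Fintype ι]

theorem measurable_quadSum (h : IsStdSample P X m) (B : ι → ι → ℝ) : Measurable (quadSum B X) := by
  unfold quadSum
  exact Finset.measurable_sum _ fun k _ => Finset.measurable_sum _ fun l _ =>
    ((h.measurable k).mul (h.measurable l)).const_mul _

end IsStdSample

end Moments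

/-! ### Second moments of quadratic forms, fourth and third moments of linear forms. -/

section QuadraticForms

open Set Filter Topology

namespace IsStdSample

variable {Ω ι : Type*} [MeasurableSpace Ω] {P : Measure Ω} [IsProbabilityMeasure P]
  {X : ι → Ω → ℝ} {m : ℝ} [DecidableEq ι] [Fintype ι]

theorem measurable_linSum (h : IsStdSample P X m) (b : ι → ℝ) : Measurable (linSum b X) := by
  unfold linSum
  exact Finset.measurable_sum _ fun l _ => (h.measurable l).const_mul _

theorem integrable_quadSum (h : IsStdSample P X m) (B : ι → ι → ℝ) :
    Integrable (quadSum B X) P := by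
  unfold quadSum
  exact integrable_finsetSum _ fun k _ => integrable_finsetSum _ fun l _ =>
    (h.integrable_two k l).const_mul _

theorem integral_quadSum (h : IsStdSample P X m) (B : ι → ι → ℝ) :
    ∫ ω, quadSum B X ω ∂P = ∑ k, B k k := by
  unfold quadSum
  rw [integral_finsetSum _ fun k _ => integrable_finsetSum _ fun l _ =>
    (h.integrable_two k l).const_mul _]
  refine Finset.sum_congr rfl fun k _ => ?_
  rw [integral_finsetSum _ fun l _ => (h.integrable_two k l).const_mul _]
  simp [integral_const_mul, h.integral_mul]

theorem integrable_quadSum_sq (h : IsStdSample P X m) (B : ι → ι → ℝ) :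
    Integrable (fun ω => quadSum B X ω ^ 2) P := by
  simp only [quadSum_sq]
  exact integrable_finsetSum _ fun k _ => integrable_finsetSum _ fun l _ =>
    integrable_finsetSum _ fun i _ => integrable_finsetSum _ fun j _ =>
    (h.integrable_four k l i j).const_mul _

/-- The second moment of a quadratic form. -/
theorem integral_quadSum_sq (h : IsStdSample P X m) {B : ι → ι → ℝ} (hB : ∀ k l, B k l = B l k) :
    ∫ ω, quadSum B X ω ^ 2 ∂P =
      (∑ k, B k k) ^ 2 + 2 * ∑ k, ∑ l, B k l ^ 2 + (m - 3) * ∑ k, B k k ^ 2 := by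
  simp only [quadSum_sq]
  have e : ∫ ω, (∑ k, ∑ l, ∑ i, ∑ j, B k l * B i j * (X k ω * X l ω * (X i ω * X j ω))) ∂P =
      ∑ k, ∑ l, ∑ i, ∑ j, B k l * B i j * ∫ ω, X k ω * X l ω * (X i ω * X j ω) ∂P := by
    rw [integral_finsetSum _ fun k _ => integrable_finsetSum _ fun l _ =>
      integrable_finsetSum _ fun i _ => integrable_finsetSum _ fun j _ =>
      (h.integrable_four k l i j).const_mul _]
    refine Finset.sum_congr rfl fun k _ => ?_
    rw [integral_finsetSum _ fun l _ =>
      integrable_finsetSum _ fun i _ => integrable_finsetSum _ fun j _ =>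
      (h.integrable_four k l i j).const_mul _]
    refine Finset.sum_congr rfl fun l _ => ?_
    rw [integral_finsetSum _ fun i _ => integrable_finsetSum _ fun j _ =>
      (h.integrable_four k l i j).const_mul _]
    refine Finset.sum_congr rfl fun i _ => ?_
    rw [integral_finsetSum _ fun j _ => (h.integrable_four k l i j).const_mul _]
    exact Finset.sum_congr rfl fun j _ => integral_const_mul _ _
  rw [e]
  simp only [h.integral_mul_four, mul_add, Finset.sum_add_distrib, mul_ite, mul_one, mul_zero]
  have e1 : ∑ k, ∑ l, ∑ i, ∑ j, (if k = l then if i = j then B k l * B i j else 0 else 0)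
      = (∑ k, B k k) ^ 2 := by
    have : ∀ k l i, ∑ j, (if k = l then if i = j then B k l * B i j else 0 else 0)
        = if k = l then B k l * B i i else 0 := fun k l i => by
      split_ifs <;> simp
    simp only [this]
    rw [sq, Finset.sum_mul_sum]
    refine Finset.sum_congr rfl fun k _ => ?_
    rw [Finset.sum_comm]
    simp
  have e2 : ∑ k, ∑ l, ∑ i, ∑ j, (if k = i then if l = j then B k l * B i j else 0 else 0)
      = ∑ k, ∑ l, B k l ^ 2 := by
    have : ∀ k l i, ∑ j, (if k = i then if l = j then B k l * B i j else 0 else 0)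
        = if k = i then B k l * B i l else 0 := fun k l i => by
      split_ifs <;> simp
    simp [this, sq]
  have e3 : ∑ k, ∑ l, ∑ i, ∑ j, (if k = j then if l = i then B k l * B i j else 0 else 0)
      = ∑ k, ∑ l, B k l ^ 2 := by
    have : ∀ k l i, ∑ j, (if k = j then if l = i then B k l * B i j else 0 else 0)
        = if l = i then B k l * B i k else 0 := fun k l i => by
      simp
    simp only [this, Finset.sum_ite_eq, Finset.mem_univ, if_true]
    exact Finset.sum_congr rfl fun k _ => Finset.sum_congr rfl fun l _ => by rw [hB l k, sq]
  have e4 : ∑ k, ∑ l, ∑ i, ∑ j, (if k = l then if k = i then if k = j then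
      B k l * B i j * (m - 3) else 0 else 0 else 0) = (m - 3) * ∑ k, B k k ^ 2 := by
    have : ∀ k l i, ∑ j, (if k = l then if k = i then if k = j then
        B k l * B i j * (m - 3) else 0 else 0 else 0)
        = if k = i then if k = l then B k l * B i k * (m - 3) else 0 else 0 := fun k l i => by
      split_ifs <;> simp
    simp only [this, Finset.sum_ite_eq, Finset.mem_univ, if_true]
    rw [Finset.mul_sum]
    exact Finset.sum_congr rfl fun k _ => by ring
  simp only [e1, e2, e3, e4]
  ring

theorem integral_linSum_sq (h : IsStdSample P X m) (b : ι → ℝ) :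
    ∫ ω, linSum b X ω ^ 2 ∂P = ∑ l, b l ^ 2 := by
  simp only [linSum_sq, h.integral_quadSum]
  exact Finset.sum_congr rfl fun l _ => (sq _).symm

theorem integrable_linSum_pow_four (h : IsStdSample P X m) (b : ι → ℝ) :
    Integrable (fun ω => linSum b X ω ^ 4) P := by
  have e : ∀ ω, linSum b X ω ^ 4 = quadSum (fun k l => b k * b l) X ω ^ 2 := fun ω => by
    rw [← linSum_sq]; ring
  simp only [e, h.integrable_quadSum_sq]

/-- Take the rank-one matrix `b_k b_l` in `integral_quadSum_sq`: the value is `3 (∑ b²)² + (m - 3) ∑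
b⁴`, where `0 ≤ ∑ b⁴ ≤ (∑ b²)²`. The maximum covers both signs of `m - 3`. -/
theorem integral_linSum_pow_four_le (h : IsStdSample P X m) (b : ι → ℝ) :
    ∫ ω, linSum b X ω ^ 4 ∂P ≤ max m 3 * (∑ l, b l ^ 2) ^ 2 := by
  have e : ∀ ω, linSum b X ω ^ 4 = quadSum (fun k l => b k * b l) X ω ^ 2 := fun ω => by
    rw [← linSum_sq]; ring
  simp only [e]
  rw [h.integral_quadSum_sq fun k l => mul_comm _ _]
  have e1 : ∑ k, b k * b k = ∑ l, b l ^ 2 := Finset.sum_congr rfl fun k _ => (sq _).symm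
  have e2 : ∑ k, ∑ l, (b k * b l) ^ 2 = (∑ l, b l ^ 2) ^ 2 := by
    rw [sq, Finset.sum_mul_sum]
    simp [mul_pow]
  have e3 : ∑ k, (b k * b k) ^ 2 ≤ (∑ l, b l ^ 2) ^ 2 := by
    have : ∀ k, (b k * b k) ^ 2 = (b k ^ 2) ^ 2 := fun k => by ring
    simp only [this]
    exact Finset.sum_sq_le_sq_sum_of_nonneg fun k _ => sq_nonneg _
  have e4 : 0 ≤ ∑ k, (b k * b k) ^ 2 := Finset.sum_nonneg fun k _ => sq_nonneg _
  rw [e1, e2]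
  rcases le_total m 3 with hm | hm
  · rw [max_eq_right hm]; nlinarith
  · rw [max_eq_left hm]; nlinarith

theorem integral_abs_linSum_pow_three_le (h : IsStdSample P X m) (b : ι → ℝ) :
    ∫ ω, |linSum b X ω| ^ 3 ∂P ≤ √(max m 3) * (√(∑ l, b l ^ 2) * ∑ l, b l ^ 2) := by
  have hs : 0 ≤ ∑ l, b l ^ 2 := Finset.sum_nonneg fun k _ => sq_nonneg _
  refine (integral_abs_pow_three_le (h.measurable_linSum b).aestronglyMeasurable
    (h.integrable_linSum_pow_four b)).trans ?_
  rw [h.integral_linSum_sq]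
  refine (Real.sqrt_le_sqrt (mul_le_mul_of_nonneg_left (h.integral_linSum_pow_four_le b) hs)).trans
    (le_of_eq ?_)
  rw [show (∑ l, b l ^ 2) * (max m 3 * (∑ l, b l ^ 2) ^ 2)
    = max m 3 * ((∑ l, b l ^ 2) * (∑ l, b l ^ 2) ^ 2) by ring,
    Real.sqrt_mul (by positivity), Real.sqrt_mul hs, Real.sqrt_sq hs]

end IsStdSample

end QuadraticForms

/-! ### Integrating out one independent variable. -/

section LeaveOneOut

open Set Filter Topology

/-- The Stein identity error when one independent centred factor `Z` is integrated out. -/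
theorem abs_integral_leave_one_out_le {Ω : Type*} [MeasurableSpace Ω] {P : Measure Ω}
    [IsProbabilityMeasure P] {Z V W : Ω → ℝ} (hZ : Measurable Z) (hV : Measurable V)
    (hW : Measurable W) (hind : IndepFun Z (fun ω => (V ω, W ω)) P)
    (hZ4 : Integrable (fun ω => Z ω ^ 4) P) (hmean : ∫ ω, Z ω ∂P = 0)
    (hvar : ∫ ω, Z ω ^ 2 ∂P = 1) (hV3 : Integrable (fun ω => |V ω| ^ 3) P)
    {f f' : ℝ → ℝ} (hf : ∀ x, HasDerivAt f (f' x) x)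
    (hf' : ∀ x y, |f' y - f' x| ≤ 2 * |y - x|)
    (hint : Integrable (fun ω => Z ω * V ω * f (W ω + 2 * (Z ω * V ω))
      - 2 * V ω ^ 2 * f' (W ω + 2 * (Z ω * V ω))) P) :
    |∫ ω, (Z ω * V ω * f (W ω + 2 * (Z ω * V ω))
      - 2 * V ω ^ 2 * f' (W ω + 2 * (Z ω * V ω))) ∂P|
      ≤ 8 * zeroBiasBound (∫ ω, Z ω ^ 4 ∂P) * ∫ ω, |V ω| ^ 3 ∂P := by
  have hc : Continuous f := continuous_iff_continuousAt.2 fun x => (hf x).continuousAt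
  have hc' : Continuous f' := by
    have : LipschitzWith 2 f' := LipschitzWith.of_dist_le_mul fun x y => by
      simpa [Real.dist_eq] using hf' y x
    exact this.continuous
  set F : ℝ × (ℝ × ℝ) → ℝ := fun p => p.1 * p.2.1 * f (p.2.2 + 2 * (p.1 * p.2.1))
      - 2 * p.2.1 ^ 2 * f' (p.2.2 + 2 * (p.1 * p.2.1)) with hF
  have hFc : Continuous F := by fun_prop
  have hVW : Measurable fun ω => (V ω, W ω) := hV.prodMk hW
  have hmap := (indepFun_iff_map_prod_eq_prod_map_map hZ.aemeasurable hVW.aemeasurable).1 hind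
  set μ := P.map Z
  set ν := P.map fun ω => (V ω, W ω)
  have : IsProbabilityMeasure μ := Measure.isProbabilityMeasure_map hZ.aemeasurable
  have : IsProbabilityMeasure ν := Measure.isProbabilityMeasure_map hVW.aemeasurable
  have hFi : Integrable F (μ.prod ν) := by
    rw [← hmap]
    exact (integrable_map_measure hFc.aestronglyMeasurable (hZ.prodMk hVW).aemeasurable).2 hint
  have e1 : ∫ ω, (Z ω * V ω * f (W ω + 2 * (Z ω * V ω))
      - 2 * V ω ^ 2 * f' (W ω + 2 * (Z ω * V ω))) ∂P = ∫ q, ∫ x, F (x, q) ∂μ ∂ν := by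
    rw [← integral_prod_symm F hFi, ← hmap,
      integral_map (hZ.prodMk hVW).aemeasurable hFc.aestronglyMeasurable]
  have m1 : ∫ x, x ∂μ = 0 := by
    rw [← hmean]; exact integral_map hZ.aemeasurable aestronglyMeasurable_id
  have m2 : ∫ x, x ^ 2 ∂μ = 1 := by
    rw [← hvar]; exact integral_map hZ.aemeasurable (by fun_prop)
  have m4 : ∫ x, x ^ 4 ∂μ = ∫ ω, Z ω ^ 4 ∂P := integral_map hZ.aemeasurable (by fun_prop)
  have i4 : Integrable (fun x : ℝ => x ^ 4) μ :=
    (integrable_map_measure (by fun_prop) hZ.aemeasurable).2 hZ4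
  have iV : Integrable (fun q : ℝ × ℝ => |q.1| ^ 3) ν :=
    (integrable_map_measure (by fun_prop) hVW.aemeasurable).2 hV3
  have mV : ∫ q, |q.1| ^ 3 ∂ν = ∫ ω, |V ω| ^ 3 ∂P :=
    integral_map (f := fun q : ℝ × ℝ => |q.1| ^ 3) hVW.aemeasurable (by fun_prop)
  have hb : ∀ q : ℝ × ℝ, ‖∫ x, F (x, q) ∂μ‖
      ≤ 8 * zeroBiasBound (∫ ω, Z ω ^ 4 ∂P) * |q.1| ^ 3 := by
    -- With `(V, W) = (v, w)` frozen, apply the zero-bias estimate to `φ x = v f(w + 2 x v)`. Its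
    -- derivative `2 v² f'(w + 2 x v)` has Lipschitz constant `2 v² · 2 · 2|v| = 8 |v|³`.
    rintro ⟨v, w⟩
    have hlin : ∀ x : ℝ, HasDerivAt (fun x => w + 2 * (x * v)) (2 * v) x := fun x => by
      simpa using (((hasDerivAt_id x).mul_const v).const_mul 2).const_add w
    have hφ : ∀ x : ℝ, HasDerivAt (fun x => v * f (w + 2 * (x * v)))
        (2 * v ^ 2 * f' (w + 2 * (x * v))) x := fun x => by
      convert! ((hf _).comp x (hlin x)).const_mul v using 1
      ring
    have hL : ∀ x y : ℝ, |2 * v ^ 2 * f' (w + 2 * (y * v)) - 2 * v ^ 2 * f' (w + 2 * (x * v))|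
        ≤ 8 * |v| ^ 3 * |y - x| := fun x y => by
      rw [← mul_sub, abs_mul, abs_of_nonneg (by positivity : 0 ≤ 2 * v ^ 2)]
      refine (mul_le_mul_of_nonneg_left (hf' _ _) (by positivity)).trans (le_of_eq ?_)
      rw [show w + 2 * (y * v) - (w + 2 * (x * v)) = 2 * (v * (y - x)) by ring, abs_mul, abs_mul,
        ← sq_abs v, abs_two]
      ring
    have := abs_integral_mul_sub_deriv_le i4 m1 m2 hφ hL (by positivity) (by fun_prop)
    rw [m4] at this
    calc _ = |∫ x, (x * (v * f (w + 2 * (x * v))) - 2 * v ^ 2 * f' (w + 2 * (x * v))) ∂μ| := by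
          simp only [hF, mul_assoc, Real.norm_eq_abs]
      _ ≤ _ := this
      _ = _ := by ring
  rw [e1, ← mV, ← integral_const_mul]
  exact norm_integral_le_of_norm_le (iV.const_mul _) (Eventually.of_forall hb)

end LeaveOneOut

/-! ### Stein's method for the quadratic form. -/

section NormalApproximation

open Set Filter Topology

theorem quadSum_eq_sum_mul_linSum {Ω ι : Type*} [Fintype ι] (A : ι → ι → ℝ) (X : ι → Ω → ℝ)
    (ω : Ω) : quadSum A X ω = ∑ k, X k ω * linSum (A k) X ω := by
  refine Finset.sum_congr rfl fun k _ => ?_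
  rw [linSum, Finset.mul_sum]
  exact Finset.sum_congr rfl fun l _ => by ring

theorem sum_linSum_sq {Ω ι : Type*} [Fintype ι] (A : ι → ι → ℝ) (X : ι → Ω → ℝ) (ω : Ω) :
    ∑ k, linSum (A k) X ω ^ 2 = quadSum (fun l p => ∑ k, A k l * A k p) X ω := by
  simp only [linSum_sq, quadSum, Finset.sum_mul]
  rw [Finset.sum_comm]
  exact Finset.sum_congr rfl fun l _ => Finset.sum_comm

theorem linSum_eq_sum_erase {Ω ι : Type*} [Fintype ι] [DecidableEq ι] {b : ι → ℝ} {k : ι}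
    (hb : b k = 0) (X : ι → Ω → ℝ) (ω : Ω) :
    linSum b X ω = ∑ l : (Finset.univ.erase k : Finset ι), b l * X l ω := by
  rw [linSum, ← Finset.add_sum_erase _ _ (Finset.mem_univ k), hb, zero_mul, zero_add]
  exact (Finset.sum_coe_sort (Finset.univ.erase k) fun l => b l * X l ω).symm

/-- By symmetry, row `k` and column `k` each contribute `X_k Y_k`, and the zero diagonal prevents an
overlap. What remains does not involve `X_k`, which gives the independence below. -/
theorem quadSum_sub_eq_sum_erase {Ω ι : Type*} [Fintype ι] [DecidableEq ι] {A : ι → ι → ℝ}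
    (hA : ∀ k l, A k l = A l k) {k : ι} (hk : A k k = 0) (X : ι → Ω → ℝ) (ω : Ω) :
    quadSum A X ω - 2 * (X k ω * linSum (A k) X ω) =
      ∑ i : (Finset.univ.erase k : Finset ι), ∑ j : (Finset.univ.erase k : Finset ι),
        A i j * (X i ω * X j ω) := by
  have h1 : ∀ i, ∑ j, A i j * (X i ω * X j ω) = A k i * X i ω * X k ω
      + ∑ j ∈ Finset.univ.erase k, A i j * (X i ω * X j ω) := fun i => by
    rw [← Finset.add_sum_erase _ _ (Finset.mem_univ k), hA i k]
    ring
  have h2 : ∑ i, A k i * X i ω * X k ω = X k ω * linSum (A k) X ω := by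
    rw [linSum, Finset.mul_sum]
    exact Finset.sum_congr rfl fun i _ => by ring
  have h3 : ∑ i, ∑ j ∈ Finset.univ.erase k, A i j * (X i ω * X j ω) = X k ω * linSum (A k) X ω
      + ∑ i ∈ Finset.univ.erase k, ∑ j ∈ Finset.univ.erase k, A i j * (X i ω * X j ω) := by
    rw [← Finset.add_sum_erase _ _ (Finset.mem_univ k), linSum,
      ← Finset.add_sum_erase _ (fun l => A k l * X l ω) (Finset.mem_univ k), hk, zero_mul,
      zero_add, Finset.mul_sum]
    congr 1
    exact Finset.sum_congr rfl fun i _ => by ring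
  have h4 : ∑ i : (Finset.univ.erase k : Finset ι), ∑ j : (Finset.univ.erase k : Finset ι),
        A i j * (X i ω * X j ω) =
      ∑ i ∈ Finset.univ.erase k, ∑ j ∈ Finset.univ.erase k, A i j * (X i ω * X j ω) := by
    rw [← Finset.sum_coe_sort (Finset.univ.erase k)]
    exact Finset.sum_congr rfl fun i _ =>
      Finset.sum_coe_sort (Finset.univ.erase k) fun j => A i j * (X i ω * X j ω)
  rw [h4, quadSum]
  simp only [h1, Finset.sum_add_distrib, h2, h3]
  ring

namespace IsStdSample

variable {Ω ι : Type*} [MeasurableSpace Ω] {P : Measure Ω} [IsProbabilityMeasure P]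
  {X : ι → Ω → ℝ} {m : ℝ} [DecidableEq ι] [Fintype ι]

theorem indepFun_linSum_quadSum (h : IsStdSample P X m) {A : ι → ι → ℝ}
    (hA : ∀ k l, A k l = A l k) {k : ι} (hk : A k k = 0) :
    IndepFun (X k) (fun ω => (linSum (A k) X ω,
      quadSum A X ω - 2 * (X k ω * linSum (A k) X ω))) P := by
  have hi := h.indep.indepFun_finset {k} (Finset.univ.erase k) (by simp) h.measurable
  have hm1 : Measurable fun g : ↥({k} : Finset ι) → ℝ => g ⟨k, by simp⟩ := by fun_prop
  have hm2 : Measurable fun g : ↥(Finset.univ.erase k) → ℝ =>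
      (∑ l : ↥(Finset.univ.erase k), A k l * g l,
        ∑ i : ↥(Finset.univ.erase k), ∑ j : ↥(Finset.univ.erase k), A i j * (g i * g j)) := by
    fun_prop
  have := hi.comp hm1 hm2
  simp only [quadSum_sub_eq_sum_erase hA hk]
  simp only [linSum_eq_sum_erase hk]
  exact this

theorem integrable_sq_mul_linSum_sq (h : IsStdSample P X m) (k : ι) (b : ι → ℝ) :
    Integrable (fun ω => (X k ω * linSum b X ω) ^ 2) P := by
  refine ((h.integrable_pow_four k).add (h.integrable_linSum_pow_four b)).mono'
    (((h.measurable k).mul (h.measurable_linSum b)).pow_const 2).aestronglyMeasurable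
    (Eventually.of_forall fun ω => ?_)
  rw [Real.norm_of_nonneg (sq_nonneg _), Pi.add_apply]
  nlinarith [sq_nonneg (X k ω ^ 2 - linSum b X ω ^ 2), sq_nonneg (X k ω ^ 2),
    sq_nonneg (linSum b X ω ^ 2)]

/-- The sum `∑ Y_k²` is the quadratic form of `B = AᵀA`, of trace `1/2`. So the integrand is centred
before taking absolute values, and its second moment is `8 ∑ B_{l,p}² + 4 (m - 3) ∑ B_{l,l}²`. -/
theorem integral_abs_one_sub_le (h : IsStdSample P X m) {A : ι → ι → ℝ}
    (hA2 : ∑ k, ∑ l, A k l ^ 2 = 1 / 2) :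
    ∫ ω, |1 - 2 * ∑ k, linSum (A k) X ω ^ 2| ∂P ≤
      2 * √(m * ∑ l, (∑ k, A k l ^ 2) ^ 2 + 2 * ∑ l, ∑ p, (∑ k, A k l * A k p) ^ 2) := by
  simp only [sum_linSum_sq]
  set B : ι → ι → ℝ := fun l p => ∑ k, A k l * A k p with hB
  have hd : ∀ l, B l l = ∑ k, A k l ^ 2 := fun l => by simp only [hB, sq]
  have htr : ∑ l, B l l = 1 / 2 := by
    simp only [hd]
    rw [Finset.sum_comm, hA2]
  have i1 := h.integrable_quadSum B
  have i2 := h.integrable_quadSum_sq B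
  have e : ∀ ω, (1 - 2 * quadSum B X ω) ^ 2 =
      1 + (4 * quadSum B X ω ^ 2 - 4 * quadSum B X ω) := fun ω => by ring
  have j1 : Integrable (fun ω => 4 * quadSum B X ω ^ 2 - 4 * quadSum B X ω) P :=
    (i2.const_mul 4).sub (i1.const_mul 4)
  have j2 : Integrable (fun ω => (1 - 2 * quadSum B X ω) ^ 2) P := by
    simp only [e]
    exact (integrable_const _).add j1
  have j3 : Integrable (fun ω => |1 - 2 * quadSum B X ω|) P :=
    ((integrable_const (1 : ℝ)).sub (i1.const_mul 2)).abs
  have hval : ∫ ω, (1 - 2 * quadSum B X ω) ^ 2 ∂P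
      = 8 * ∑ l, ∑ p, B l p ^ 2 + 4 * (m - 3) * ∑ l, B l l ^ 2 := by
    simp only [e]
    rw [integral_add (integrable_const _) j1, integral_sub (i2.const_mul 4) (i1.const_mul 4),
      integral_const_mul, integral_const_mul, h.integral_quadSum,
      h.integral_quadSum_sq fun k l => Finset.sum_congr rfl fun i _ => mul_comm _ _, htr]
    simp; ring
  have hcs := integral_mul_le_sqrt (μ := P) (f := fun ω => |1 - 2 * quadSum B X ω|)
    (g := fun _ => 1) (by simpa only [sq_abs] using j2) (by simp) (by simpa using j3)
  simp only [mul_one, sq_abs, one_pow, integral_const, probReal_univ, smul_eq_mul] at hcs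
  refine hcs.trans ?_
  -- This rewrites every real `2`, including the one under the root; that one is restored after the
  -- roots are compared.
  rw [hval, show (2 : ℝ) = √4 by rw [show (4 : ℝ) = 2 ^ 2 by norm_num]; simp,
    ← Real.sqrt_mul (by norm_num)]
  refine Real.sqrt_le_sqrt ?_
  rw [show √(4 : ℝ) = 2 by rw [show (4 : ℝ) = 2 ^ 2 by norm_num]; simp]
  simp only [← hd]
  -- Only the negative contribution `-12 ∑ B_{l,l}²` is discarded.
  have : 0 ≤ ∑ l, B l l ^ 2 := Finset.sum_nonneg fun l _ => sq_nonneg _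
  linarith

/-- Add and subtract `2 ∑ Y_k² f'(Q)`: one part carries the factor `1 - 2 ∑ Y_k²`, the other is a
sum of leave-one-out errors. -/
theorem abs_integral_stein_le (h : IsStdSample P X m) [Nonempty ι] {A : ι → ι → ℝ}
    (hA : ∀ k l, A k l = A l k) (hk : ∀ k, A k k = 0) (hA2 : ∑ k, ∑ l, A k l ^ 2 = 1 / 2)
    {f f' : ℝ → ℝ} (hf : ∀ x, HasDerivAt f (f' x) x) (hf1 : ∀ x, |f' x| ≤ 1)
    (hf2 : ∀ x y, |f' y - f' x| ≤ 2 * |y - x|) :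
    |∫ ω, (f' (quadSum A X ω) - quadSum A X ω * f (quadSum A X ω)) ∂P| ≤
      2 * √(m * ∑ l, (∑ k, A k l ^ 2) ^ 2 + 2 * ∑ l, ∑ p, (∑ k, A k l * A k p) ^ 2)
      + ∑ k, 8 * zeroBiasBound m * ∫ ω, |linSum (A k) X ω| ^ 3 ∂P := by
  have hc : Continuous f := continuous_iff_continuousAt.2 fun x => (hf x).continuousAt
  have hc' : Continuous f' := by
    have : LipschitzWith 2 f' := LipschitzWith.of_dist_le_mul fun x y => by
      simpa [Real.dist_eq] using hf2 y x
    exact this.continuous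
  have hQ := h.measurable_quadSum A
  have iQ2 := h.integrable_quadSum_sq A
  have iY2 : ∀ k, Integrable (fun ω => linSum (A k) X ω ^ 2) P := fun k => by
    simp only [linSum_sq]; exact h.integrable_quadSum _
  have hflin : ∀ x, |f x| ≤ |f 0| + |x| := fun x => by
    have := norm_sub_le_of_hasDerivAt hf hf1 0 x
    rw [sub_zero] at this
    linarith [abs_sub_abs_le_abs_sub (f x) (f 0)]
  have ifY : ∀ k, Integrable (fun ω => 2 * linSum (A k) X ω ^ 2 * f' (quadSum A X ω)) P :=
    fun k => ((iY2 k).const_mul 2).mul_bdd (c := 1)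
      (hc'.measurable.comp hQ).aestronglyMeasurable (Eventually.of_forall fun ω => hf1 _)
  have ifX : ∀ k, Integrable (fun ω => X k ω * linSum (A k) X ω * f (quadSum A X ω)) P := by
    intro k
    refine (((integrable_const (f 0 ^ 2)).add iQ2).add
      (h.integrable_sq_mul_linSum_sq k (A k))).mono'
      (((h.measurable k).mul (h.measurable_linSum _)).mul (hc.measurable.comp hQ)).aestronglyMeasurable
      (Eventually.of_forall fun ω => ?_)
    rw [norm_mul, Real.norm_eq_abs, Real.norm_eq_abs]
    simp only [Pi.add_apply]
    rw [← sq_abs (f 0), ← sq_abs (quadSum A X ω), ← sq_abs (X k ω * linSum (A k) X ω)]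
    have := mul_le_mul_of_nonneg_left (hflin (quadSum A X ω))
      (abs_nonneg (X k ω * linSum (A k) X ω))
    nlinarith [sq_nonneg (|X k ω * linSum (A k) X ω| / 2 - |f 0|), sq_nonneg |f 0|,
      sq_nonneg (|X k ω * linSum (A k) X ω| / 2 - |quadSum A X ω|),
      sq_nonneg |X k ω * linSum (A k) X ω|]
  have id : ∀ k, Integrable (fun ω => X k ω * linSum (A k) X ω * f (quadSum A X ω)
      - 2 * linSum (A k) X ω ^ 2 * f' (quadSum A X ω)) P := fun k => (ifX k).sub (ifY k)
  have imain : Integrable (fun ω => (1 - 2 * ∑ k, linSum (A k) X ω ^ 2) * f' (quadSum A X ω)) P :=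
    ((integrable_const (1 : ℝ)).sub ((integrable_finsetSum _ fun k _ => iY2 k).const_mul 2)).mul_bdd
      (c := 1) (hc'.measurable.comp hQ).aestronglyMeasurable (Eventually.of_forall fun ω => hf1 _)
  have e : ∀ ω, f' (quadSum A X ω) - quadSum A X ω * f (quadSum A X ω) =
      (1 - 2 * ∑ k, linSum (A k) X ω ^ 2) * f' (quadSum A X ω)
      - ∑ k, (X k ω * linSum (A k) X ω * f (quadSum A X ω)
        - 2 * linSum (A k) X ω ^ 2 * f' (quadSum A X ω)) := fun ω => by
    rw [Finset.sum_sub_distrib, ← Finset.sum_mul, ← Finset.sum_mul, ← quadSum_eq_sum_mul_linSum,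
      ← Finset.mul_sum]
    ring
  simp only [e]
  rw [integral_sub imain (integrable_finsetSum _ fun k _ => id k),
    integral_finsetSum _ fun k _ => id k]
  refine (abs_sub _ _).trans (add_le_add ?_ ((Finset.abs_sum_le_sum_abs _ _).trans
    (Finset.sum_le_sum fun k _ => ?_)))
  · refine le_trans ?_ (h.integral_abs_one_sub_le hA2)
    refine norm_integral_le_of_norm_le (f := fun ω =>
      (1 - 2 * ∑ k, linSum (A k) X ω ^ 2) * f' (quadSum A X ω))
      (((integrable_const (1 : ℝ)).sub
        ((integrable_finsetSum _ fun k _ => iY2 k).const_mul 2)).abs)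
      (Eventually.of_forall fun ω => ?_)
    rw [norm_mul]
    exact mul_le_of_le_one_right (norm_nonneg _) (hf1 _)
  · have hi := abs_integral_leave_one_out_le (h.measurable k) (h.measurable_linSum (A k))
      (hQ.sub (((h.measurable k).mul (h.measurable_linSum (A k))).const_mul 2))
      (h.indepFun_linSum_quadSum hA (hk k)) (h.integrable_pow_four k) (h.mean k) (h.var k)
      (integrable_abs_pow_of_pow_four (h.measurable_linSum (A k)).aestronglyMeasurable
        (h.integrable_linSum_pow_four (A k)) (by norm_num)) hf hf2
      (by simpa using id k)
    simpa [h.fourth k] using hi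

theorem sum_integral_abs_pow_three_le (h : IsStdSample P X m) [Nonempty ι] {A : ι → ι → ℝ}
    (hA2 : ∑ k, ∑ l, A k l ^ 2 = 1 / 2) :
    ∑ k, 8 * zeroBiasBound m * ∫ ω, |linSum (A k) X ω| ^ 3 ∂P ≤
      4 * √((3 * m + m ^ 2) * ∑ k, (∑ l, A k l ^ 2) ^ 2) := by
  have hm : 1 ≤ m := h.one_le (Classical.arbitrary ι)
  set s : ι → ℝ := fun k => ∑ l, A k l ^ 2 with hs
  have hs0 : ∀ k, 0 ≤ s k := fun k => Finset.sum_nonneg fun l _ => sq_nonneg _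
  have hz : 0 ≤ zeroBiasBound m := by unfold zeroBiasBound; positivity
  have hT : 0 ≤ ∑ k, s k ^ 2 := Finset.sum_nonneg fun k _ => sq_nonneg _
  -- Cauchy–Schwarz over `k`, using `∑ s k = 1/2`.
  have h1 : ∑ k, √(s k) * s k ≤ √(1 / 2) * √(∑ k, s k ^ 2) := by
    have := Real.sum_sqrt_mul_sqrt_le Finset.univ hs0 fun k => sq_nonneg (s k)
    simp only [fun k => Real.sqrt_sq (hs0 k)] at this
    rwa [hA2] at this
  calc ∑ k, 8 * zeroBiasBound m * ∫ ω, |linSum (A k) X ω| ^ 3 ∂P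
      ≤ ∑ k, 8 * zeroBiasBound m * (√(max m 3) * (√(s k) * s k)) :=
        Finset.sum_le_sum fun k _ => mul_le_mul_of_nonneg_left
          (h.integral_abs_linSum_pow_three_le (A k)) (by positivity)
    _ = 8 * zeroBiasBound m * √(max m 3) * ∑ k, √(s k) * s k := by
        rw [Finset.mul_sum]
        exact Finset.sum_congr rfl fun k _ => by ring
    _ ≤ 8 * zeroBiasBound m * √(max m 3) * (√(1 / 2) * √(∑ k, s k ^ 2)) := by gcongr
    _ = 4 * √(2 * max m 3 * zeroBiasBound m ^ 2 * ∑ k, s k ^ 2) := by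
        rw [Real.sqrt_mul (by positivity), Real.sqrt_mul (by positivity), Real.sqrt_sq hz,
          Real.sqrt_mul (by positivity), show (1 / 2 : ℝ) = 2 / 2 ^ 2 by norm_num,
          Real.sqrt_div (by positivity), Real.sqrt_sq (by positivity)]
        ring
    _ ≤ _ := by
        gcongr
        linarith [two_mul_zeroBiasBound_sq_le hm]

/-- Normal approximation of a quadratic form with finite fourth moment. -/
theorem wassersteinDist_quadSum_le (h : IsStdSample P X m) [Nonempty ι] {A : ι → ι → ℝ}
    (hA : ∀ k l, A k l = A l k) (hk : ∀ k, A k k = 0) (hA2 : ∑ k, ∑ l, A k l ^ 2 = 1 / 2) :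
    wassersteinDist (P.map (quadSum A X)) (gaussianReal 0 1) ≤ ENNReal.ofReal
      (2 * √(m * ∑ l, (∑ k, A k l ^ 2) ^ 2 + 2 * ∑ l, ∑ p, (∑ k, A k l * A k p) ^ 2)
      + 4 * √((3 * m + m ^ 2) * ∑ k, (∑ l, A k l ^ 2) ^ 2)) := by
  have hQ := h.measurable_quadSum A
  have : IsProbabilityMeasure (P.map (quadSum A X)) := Measure.isProbabilityMeasure_map hQ.aemeasurable
  refine wassersteinDist_gaussian_le ?_ fun f f' hf hf1 hf2 => ?_
  · exact (integrable_map_measure aestronglyMeasurable_id hQ.aemeasurable).2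
      (h.integrable_quadSum A)
  · have hc : Continuous f := continuous_iff_continuousAt.2 fun x => (hf x).continuousAt
    have hc' : Continuous f' := by
      have : LipschitzWith 2 f' := LipschitzWith.of_dist_le_mul fun x y => by
        simpa [Real.dist_eq] using hf2 y x
      exact this.continuous
    rw [integral_map hQ.aemeasurable (by fun_prop)]
    exact (h.abs_integral_stein_le hA hk hA2 hf hf1 hf2).trans
      (add_le_add le_rfl (h.sum_integral_abs_pow_three_le hA2))

theorem sum_sq_eq_half (h : IsStdSample P X m) {A : ι → ι → ℝ}
    (hA : ∀ k l, A k l = A l k) (hk : ∀ k, A k k = 0) (h1 : ∫ ω, quadSum A X ω ^ 2 ∂P = 1) :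
    ∑ k, ∑ l, A k l ^ 2 = 1 / 2 := by
  rw [h.integral_quadSum_sq hA] at h1
  simp only [hk] at h1
  simp at h1
  linarith

end IsStdSample

end NormalApproximation

/-! ### Extended-valued bounds, the comparison with `L_n`, and the pairing example. -/

section Assembly

theorem ENNReal.ofReal_rpow_half {x : ℝ} (hx : 0 ≤ x) :
    ENNReal.ofReal x ^ (1 / 2 : ℝ) = ENNReal.ofReal √x := by
  rw [ENNReal.ofReal_rpow_of_nonneg hx (by norm_num), Real.sqrt_eq_rpow]

theorem isStdSample_of_fourthMoment_ne_top {Ω : Type*} [MeasurableSpace Ω] {P : Measure Ω}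
    {X : ℕ → Ω → ℝ} (hmeas : ∀ k, Measurable (X k)) (hindep : iIndepFun X P)
    (hident : ∀ k, IdentDistrib (X k) (X 0) P P)
    (hmean : ∀ k, ∫ ω, X k ω ∂P = 0) (hvar : ∀ k, ∫ ω, X k ω ^ 2 ∂P = 1)
    (hm : fourthMoment P (X 0) ≠ ∞) {ι : Type*} {g : ι → ℕ} (hg : Function.Injective g) :
    IsStdSample P (fun i => X (g i)) (fourthMoment P (X 0)).toReal := by
  have hpos : ∀ ω, 0 ≤ X 0 ω ^ 4 := fun ω => by positivity
  have hi0 : Integrable (fun ω => X 0 ω ^ 4) P :=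
    ⟨((hmeas 0).pow_const 4).aestronglyMeasurable,
      (hasFiniteIntegral_iff_ofReal (Filter.Eventually.of_forall hpos)).2 (lt_top_iff_ne_top.2 hm)⟩
  have hid : ∀ k, IdentDistrib (fun ω => X k ω ^ 4) (fun ω => X 0 ω ^ 4) P P := fun k =>
    (hident k).comp (u := fun x : ℝ => x ^ 4) (by fun_prop)
  refine ⟨fun i => hmeas _, hindep.precomp hg, fun i => hmean _, fun i => hvar _,
    fun i => (hid _).integrable_iff.2 hi0, fun i => ?_⟩
  rw [(hid _).integral_eq, integral_eq_lintegral_of_nonneg_ae (Filter.Eventually.of_forall hpos)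
    hi0.aestronglyMeasurable]
  rfl

theorem quadForm_eq_quadSum {Ω : Type*} {n : ℕ} (A : Matrix (Fin n) (Fin n) ℝ) (X : ℕ → Ω → ℝ) :
    quadForm A X = quadSum A (fun k : Fin n => X k) := by
  funext ω
  simp only [quadForm, quadSum, mul_assoc]

theorem wassersteinDist_bound_eq_ofReal {m T β : ℝ} (hm : 0 ≤ m) (hT : 0 ≤ T) (hβ : 0 ≤ β) :
    2 * (ENNReal.ofReal m * ENNReal.ofReal T + 2 * ENNReal.ofReal β) ^ (1 / 2 : ℝ)
      + 4 * ((3 * ENNReal.ofReal m + ENNReal.ofReal m ^ 2) * ENNReal.ofReal T) ^ (1 / 2 : ℝ) =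
    ENNReal.ofReal (2 * √(m * T + 2 * β) + 4 * √((3 * m + m ^ 2) * T)) := by
  rw [ENNReal.ofReal_add (by positivity) (by positivity), ENNReal.ofReal_mul (by norm_num),
    ENNReal.ofReal_mul (by norm_num), ← ENNReal.ofReal_rpow_half (by positivity),
    ← ENNReal.ofReal_rpow_half (by positivity), ENNReal.ofReal_add (by positivity) (by positivity),
    ENNReal.ofReal_mul hm, ENNReal.ofReal_mul (by norm_num), ENNReal.ofReal_mul (by positivity),
    ENNReal.ofReal_add (by positivity) (by positivity), ENNReal.ofReal_mul (by norm_num),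
    ENNReal.ofReal_pow hm]
  simp

theorem wassersteinDist_bound_le_max {x : ℝ≥0∞} {n M T β : ℝ} (hn : 0 < n) (hM : 0 < M)
    (hTM : T ≤ n * M ^ 2) :
    2 * (x * ENNReal.ofReal T + 2 * ENNReal.ofReal β) ^ (1 / 2 : ℝ)
      + 4 * ((3 * x + x ^ 2) * ENNReal.ofReal T) ^ (1 / 2 : ℝ) ≤
    ENNReal.ofReal (2 * √n * M) * ((x + ENNReal.ofReal (2 / (n * M ^ 2) * β)) ^ (1 / 2 : ℝ)
      + 2 * (3 * x + x ^ 2) ^ (1 / 2 : ℝ)) := by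
  have hc : ENNReal.ofReal (2 * √n * M) = 2 * ENNReal.ofReal (n * M ^ 2) ^ (1 / 2 : ℝ) := by
    rw [ENNReal.ofReal_rpow_half (by positivity), Real.sqrt_mul hn.le, Real.sqrt_sq hM.le,
      mul_assoc, ENNReal.ofReal_mul (by norm_num)]
    simp
  have hT := ENNReal.ofReal_le_ofReal hTM
  have h1 : x * ENNReal.ofReal T + 2 * ENNReal.ofReal β ≤
      ENNReal.ofReal (n * M ^ 2) * (x + ENNReal.ofReal (2 / (n * M ^ 2) * β)) := by
    rw [mul_add, ← ENNReal.ofReal_mul (p := n * M ^ 2) (by positivity),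
      show n * M ^ 2 * (2 / (n * M ^ 2) * β) = 2 * β by field_simp,
      ENNReal.ofReal_mul (p := 2) (by norm_num), mul_comm (ENNReal.ofReal (n * M ^ 2))]
    simp only [ENNReal.ofReal_ofNat]
    gcongr
  have h2 : (3 * x + x ^ 2) * ENNReal.ofReal T ≤ ENNReal.ofReal (n * M ^ 2) * (3 * x + x ^ 2) := by
    rw [mul_comm]; gcongr
  rw [hc, mul_add, mul_assoc 2, mul_assoc 2, mul_left_comm _ (2 : ℝ≥0∞), ← mul_assoc 2 2,
    ← ENNReal.mul_rpow_of_nonneg _ _ (by norm_num), ← ENNReal.mul_rpow_of_nonneg _ _ (by norm_num),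
    show (2 : ℝ≥0∞) * 2 = 4 by norm_num]
  gcongr

theorem sum_sq_le_maxRowSq {n : ℕ} (A : Matrix (Fin n) (Fin n) ℝ) (k : Fin n) :
    ∑ l, A k l ^ 2 ≤ maxRowSq A :=
  le_ciSup (f := fun k => ∑ l, A k l ^ 2) (Set.finite_range _).bddAbove k

/-- The coefficients of `(1/√n) ∑_k X_{2k} X_{2k+1}`, with the variables indexed by pairs. -/
noncomputable def pairMatrix (n : ℕ) (p q : Fin n × Bool) : ℝ :=
  if p.1 = q.1 then if p.2 = q.2 then 0 else 1 / (2 * √(n : ℝ)) else 0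

/-- Each row has a single nonzero entry, at the partner index, so distinct columns have disjoint
supports. The entry is halved because the symmetric form counts every product twice. -/
theorem pairMatrix_mul_sum {n : ℕ} (p q : Fin n × Bool) :
    ∑ k, pairMatrix n k p * pairMatrix n k q = if p = q then (1 / (2 * √(n : ℝ))) ^ 2 else 0 := by
  obtain ⟨i, a⟩ := p
  obtain ⟨j, b⟩ := q
  rw [Fintype.sum_prod_type]
  cases a <;> cases b <;> simp [pairMatrix, sq, @eq_comm _ j i]

theorem pairMatrix_sum_sq {n : ℕ} (p : Fin n × Bool) :
    ∑ q, pairMatrix n p q ^ 2 = (1 / (2 * √(n : ℝ))) ^ 2 := by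
  obtain ⟨i, a⟩ := p
  rw [Fintype.sum_prod_type]
  cases a <;> simp [pairMatrix]

theorem pairMatrix_symm {n : ℕ} (p q : Fin n × Bool) : pairMatrix n p q = pairMatrix n q p := by
  simp only [pairMatrix, eq_comm]

theorem quadSum_pairMatrix {Ω : Type*} {n : ℕ} (X : ℕ → Ω → ℝ) (ω : Ω) :
    quadSum (pairMatrix n) (fun p => X (2 * p.1 + p.2.toNat)) ω =
      1 / √(n : ℝ) * ∑ k ∈ Finset.range n, X (2 * k) ω * X (2 * k + 1) ω := by
  rw [quadSum, Fintype.sum_prod_type, Finset.sum_range, Finset.mul_sum]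
  refine Finset.sum_congr rfl fun i _ => ?_
  simp [Fintype.sum_prod_type, pairMatrix]
  ring

end Assembly

theorem corollary7p2 {Ω : Type*} [MeasurableSpace Ω] (P : Measure Ω) [IsProbabilityMeasure P]
    (X : ℕ → Ω → ℝ) (hmeas : ∀ k, Measurable (X k)) (hindep : iIndepFun X P)
    (hident : ∀ k, IdentDistrib (X k) (X 0) P P)
    (hmean : ∀ k, ∫ ω, X k ω ∂P = 0) (hvar : ∀ k, ∫ ω, X k ω ^ 2 ∂P = 1) :
    (∀ (n : ℕ) (A : Matrix (Fin n) (Fin n) ℝ), 2 ≤ n → A.IsSymm → (∀ k, A k k = 0) →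
      ∫ ω, quadForm A X ω ^ 2 ∂P = 1 →
      wassersteinDist (P.map (quadForm A X)) (gaussianReal 0 1) ≤
          2 * (fourthMoment P (X 0) * ENNReal.ofReal (∑ l, (∑ k, A k l ^ 2) ^ 2)
              + 2 * ENNReal.ofReal (∑ l, ∑ p, (∑ k, A k l * A k p) ^ 2)) ^ (1 / 2 : ℝ)
          + 4 * ((3 * fourthMoment P (X 0) + fourthMoment P (X 0) ^ 2)
              * ENNReal.ofReal (∑ k, (∑ l, A k l ^ 2) ^ 2)) ^ (1 / 2 : ℝ) ∧
      wassersteinDist (P.map (quadForm A X)) (gaussianReal 0 1) ≤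
          ENNReal.ofReal (2 * √(n : ℝ) * maxRowSq A)
          * ((fourthMoment P (X 0) + ENNReal.ofReal (2 / (n * maxRowSq A ^ 2)
                * ∑ l, ∑ p, (∑ k, A k l * A k p) ^ 2)) ^ (1 / 2 : ℝ)
            + 2 * (3 * fourthMoment P (X 0) + fourthMoment P (X 0) ^ 2) ^ (1 / 2 : ℝ))) ∧
    (∀ n : ℕ, 1 ≤ n →
      wassersteinDist
          (P.map (fun ω => 1 / √(n : ℝ) * ∑ k ∈ Finset.range n, X (2 * k) ω * X (2 * k + 1) ω))
          (gaussianReal 0 1) ≤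
        8 * fourthMoment P (X 0) / ENNReal.ofReal √(n : ℝ)) := by
  constructor
  · intro n A hn hA hd hQ
    have : Nonempty (Fin n) := ⟨⟨0, by omega⟩⟩
    have hA' : ∀ k l, A k l = A l k := fun k l => hA.apply l k
    have hT : ∑ l, (∑ k, A k l ^ 2) ^ 2 = ∑ k, (∑ l, A k l ^ 2) ^ 2 :=
      Finset.sum_congr rfl fun l _ => by simp only [hA' _ l]
    have hβ0 : 0 ≤ ∑ l, ∑ p, (∑ k, A k l * A k p) ^ 2 :=
      Finset.sum_nonneg fun l _ => Finset.sum_nonneg fun p _ => sq_nonneg _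
    have hs0 : ∀ k, 0 ≤ ∑ l, A k l ^ 2 := fun k => Finset.sum_nonneg fun l _ => sq_nonneg _
    obtain ⟨i, j, hij⟩ : ∃ i j, A i j ≠ 0 := by
      by_contra! h
      simp [quadForm, h] at hQ
    have hsi : 0 < ∑ l, A i l ^ 2 :=
      (sq_pos_of_ne_zero hij).trans_le
        (Finset.single_le_sum (f := fun l => A i l ^ 2) (fun l _ => sq_nonneg _)
          (Finset.mem_univ j))
    have hTpos : 0 < ∑ k, (∑ l, A k l ^ 2) ^ 2 :=
      (pow_pos hsi 2).trans_le
        (Finset.single_le_sum (f := fun k => (∑ l, A k l ^ 2) ^ 2) (fun l _ => sq_nonneg _)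
          (Finset.mem_univ i))
    have hTM : ∑ k, (∑ l, A k l ^ 2) ^ 2 ≤ n * maxRowSq A ^ 2 := by
      calc ∑ k, (∑ l, A k l ^ 2) ^ 2 ≤ ∑ k : Fin n, maxRowSq A ^ 2 :=
            Finset.sum_le_sum fun k _ => pow_le_pow_left₀ (hs0 k) (sum_sq_le_maxRowSq A k) 2
        _ = _ := by simp
    rw [hT]
    have main : wassersteinDist (P.map (quadForm A X)) (gaussianReal 0 1) ≤
          2 * (fourthMoment P (X 0) * ENNReal.ofReal (∑ k, (∑ l, A k l ^ 2) ^ 2)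
              + 2 * ENNReal.ofReal (∑ l, ∑ p, (∑ k, A k l * A k p) ^ 2)) ^ (1 / 2 : ℝ)
          + 4 * ((3 * fourthMoment P (X 0) + fourthMoment P (X 0) ^ 2)
              * ENNReal.ofReal (∑ k, (∑ l, A k l ^ 2) ^ 2)) ^ (1 / 2 : ℝ) := by
      by_cases hm : fourthMoment P (X 0) = ∞
      -- Nonvanishing of the row sums matters: in `ℝ≥0∞`, `∞ * 0 = 0` would not give an infinite
      -- bound.
      · have hT' : ENNReal.ofReal (∑ k, (∑ l, A k l ^ 2) ^ 2) ≠ 0 :=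
          (ENNReal.ofReal_pos.2 hTpos).ne'
        rw [hm, ENNReal.top_mul hT', top_add, ENNReal.top_rpow_of_pos (by norm_num),
          ENNReal.mul_top (by norm_num), top_add]
        exact le_top
      · have hS := isStdSample_of_fourthMoment_ne_top hmeas hindep hident hmean hvar hm
          (g := fun k : Fin n => (k : ℕ)) Fin.val_injective
        rw [quadForm_eq_quadSum] at hQ ⊢
        have h := hS.wassersteinDist_quadSum_le hA' hd (hS.sum_sq_eq_half hA' hd hQ)
        rw [hT, ← wassersteinDist_bound_eq_ofReal ENNReal.toReal_nonneg hTpos.le hβ0,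
          ENNReal.ofReal_toReal hm] at h
        exact h
    exact ⟨main, main.trans (wassersteinDist_bound_le_max (Nat.cast_pos.2 (by omega))
      (hsi.trans_le (sum_sq_le_maxRowSq A i)) hTM)⟩
  · intro n hn
    by_cases hm : fourthMoment P (X 0) = ∞
    · rw [hm, ENNReal.mul_top (by norm_num), ENNReal.top_div_of_ne_top ENNReal.ofReal_ne_top]
      exact le_top
    have hg : Function.Injective fun p : Fin n × Bool => 2 * (p.1 : ℕ) + p.2.toNat := by
      rintro ⟨i, a⟩ ⟨j, b⟩ h
      cases a <;> cases b <;> simp [Prod.ext_iff, Fin.ext_iff] at h ⊢ <;> omega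
    have hS := isStdSample_of_fourthMoment_ne_top hmeas hindep hident hmean hvar hm hg
    have hn0 : (0 : ℝ) < n := Nat.cast_pos.2 (by omega)
    have : Nonempty (Fin n × Bool) := ⟨⟨⟨0, by omega⟩, true⟩⟩
    have hcard : (Fintype.card (Fin n × Bool) : ℝ) = n * 2 := by simp
    set c : ℝ := (1 / (2 * √(n : ℝ))) ^ 2 with hc
    have hcn : c = 1 / (4 * n) := by
      rw [hc, div_pow, mul_pow, Real.sq_sqrt hn0.le]; norm_num
    have hm1 := hS.one_le (Classical.arbitrary _)
    have h := hS.wassersteinDist_quadSum_le (A := pairMatrix n) pairMatrix_symm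
      (fun p => by simp [pairMatrix]) (by
        simp only [pairMatrix_sum_sq, ← hc, Finset.sum_const, Finset.card_univ, nsmul_eq_mul,
          hcard, hcn]
        field_simp; norm_num)
    have e : quadSum (pairMatrix n) (fun p => X (2 * p.1 + p.2.toNat)) =
        fun ω => 1 / √(n : ℝ) * ∑ k ∈ Finset.range n, X (2 * k) ω * X (2 * k + 1) ω :=
      funext fun ω => quadSum_pairMatrix X ω
    rw [e] at h
    refine h.trans ?_
    set m := (fourthMoment P (X 0)).toReal with hmdef
    have hfm : fourthMoment P (X 0) = ENNReal.ofReal m := (ENNReal.ofReal_toReal hm).symm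
    have e8 : 8 * ENNReal.ofReal m / ENNReal.ofReal √(n : ℝ) = ENNReal.ofReal (8 * m / √(n : ℝ)) := by
      rw [ENNReal.ofReal_div_of_pos (Real.sqrt_pos.2 hn0), ENNReal.ofReal_mul (by norm_num)]
      simp
    rw [hfm, e8]
    refine ENNReal.ofReal_le_ofReal ?_
    have hcol : ∀ l, ∑ k, pairMatrix n k l ^ 2 = c := fun l => by
      simp only [pairMatrix_symm _ l, pairMatrix_sum_sq, ← hc]
    simp only [pairMatrix_mul_sum, pairMatrix_sum_sq, ← hc, hcol, ite_pow, ne_eq, OfNat.ofNat_ne_zero,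
      not_false_eq_true, zero_pow, Finset.sum_ite_eq, Finset.mem_univ, if_true, Finset.sum_const,
      Finset.card_univ, nsmul_eq_mul, hcard]
    -- Here `AᵀA` is `c` times the identity in dimension `2n`, so the two sums in the bound
    -- coincide, with value `2 n c² = 1 / (8 n)`.
    have hv : (n : ℝ) * 2 * c ^ 2 = (1 / √(n : ℝ)) ^ 2 / 8 := by
      rw [hcn, div_pow 1 √(n : ℝ), Real.sq_sqrt hn0.le]; field_simp; norm_num
    rw [hv]
    set r : ℝ := 1 / √(n : ℝ) with hr
    have hr0 : 0 ≤ r := by positivity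
    -- As `m ≥ 1`, each root is at most `m r`; the total `6 m r` is below the claimed `8 m r`.
    have b1 : √(m * (r ^ 2 / 8) + 2 * (r ^ 2 / 8)) ≤ m * r :=
      Real.sqrt_le_iff.2 ⟨by positivity, by
        nlinarith [mul_nonneg (sq_nonneg r) (show 0 ≤ m ^ 2 - (m + 2) / 8 by nlinarith)]⟩
    have b2 : √((3 * m + m ^ 2) * (r ^ 2 / 8)) ≤ m * r :=
      Real.sqrt_le_iff.2 ⟨by positivity, by
        nlinarith [mul_nonneg (sq_nonneg r) (show 0 ≤ m * (m - 1) by nlinarith)]⟩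
    have : 8 * m / √(n : ℝ) = 8 * (m * r) := by rw [hr]; ring
    rw [this]
    have : 0 ≤ m * r := by positivity
    linarith
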